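/- Let $\Omega\Subset\mathbb{C}^2$ be a bounded pseudoconvex domain with $\mathcal{C}^\infty$-smooth boundary. A smooth defining function for $\Omega$ is a smooth function $r\colon U\to\mathbb{R}$ on an open neighborhood $U$ of $b\Omega$ with $\Omega\cap U=\{r<0\}$ and $dr\neq 0$ on $b\Omega$. For $p\in b\Omega$, let $r$ be a smooth local defining function and $L$ a nonvanishing smooth tangential $(1,0)$-vector field near $p$, and let $\lambda=\sum_{j,k}\frac{\partial^2 r}{\partial z_j\partial\bar z_k}L^j\overline{L^k}$. The type $c_p$ of $b\Omega$ at $p$ is the least integer $k\ge 2$ such that $(L_{k-2}\cdots L_1\lambda)(p)\neq0$ for some $L_1,\dots,L_{k-2}\in\{L,\bar L\}$ (and $p$ is of infinite type if there is none); it does not depend on the choice of $r$ and $L$. Suppose that (i) $c_p\neq 4$ for all $p\in b\Omega$ (points of infinite type are allowed), and (ii) $\Omega$ admits a smooth defining function whose complex Hessian is positive semi-definite on all of $\mathbb{C}^2$ at every point of $b\Omega$ (it is plurisubharmonic on $b\Omega$). Then the following hold. (a) For every $\eta\in(0,1)$ there exist a smooth defining function $r$ for $\Omega$, a constant $K>0$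 and an open neighborhood $U$ of $b\Omega$ in the domain of $r$ such that $-r-Kr^2>0$ on $\Omega\cap U$ and $-(-r-Kr^2)^\eta$ is plurisubharmonic on $\Omega\cap U$. (b) For every $\mu>1$ there exist a smooth defining function $r$ for $\Omega$, a constant $K>0$ and an open neighborhood $U$ of $b\Omega$ in the domain of $r$ such that $r+Kr^2>0$ on $U\setminus\overline\Omega$ and $(r+Kr^2)^\mu$ is plurisubharmonic on $U\setminus\overline\Omega$. (c) The Diederich–Fornæss index and the Steinness index of $\Omega$ are both equal to $1$. Here the Diederich–Fornæss index is the supremum of all $\eta\in(0,1)$ for which there is a smooth defining function $r\colon U\to\mathbb{R}$ for $\Omega$ such that $-(-r)^\eta$ is strictly plurisubharmonic on $\Omega\cap U$, and the Steinness index is the infimum of all $\mu>1$ for which there is a smooth defining function $r\colon U\to\mathbb{R}$ for $\Omega$ such that $r^\mu$ is strictly plurisubharmonic on $U\setminus\overline\Omega$. -/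

import Mathlib

open Set Complex
open scoped ContDiff ENNReal

/-- The space `ℂ²` with its Euclidean norm. -/
abbrev CC2 : Type := EuclideanSpace ℂ (Fin 2)

/-- `∑ j, ξ j * (∂f/∂z_j)(z)`: the value of the `(1,0)`-form `∂f` at `z` on `ξ`; the coordinate-free
form of `∂/∂z_j = (∂/∂x_j - i ∂/∂y_j) / 2`. -/
noncomputable def del (f : CC2 → ℂ) (z ξ : CC2) : ℂ :=
  (fderiv ℝ f z ξ - I * fderiv ℝ f z (I • ξ)) / 2

/-- `∑ k, conj (ξ k) * (∂f/∂z̄_k)(z)`: the value of `∂̄f` at `z` on the conjugate of `ξ`. -/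
noncomputable def delbar (f : CC2 → ℂ) (z ξ : CC2) : ℂ :=
  (fderiv ℝ f z ξ + I * fderiv ℝ f z (I • ξ)) / 2

/-- The complex Hessian form `∑ j k, (∂²f/∂z_j∂z̄_k)(z) * ξ j * conj (ζ k)`. -/
noncomputable def complexHessian (f : CC2 → ℂ) (z ξ ζ : CC2) : ℂ :=
  del (fun w => delbar f w ζ) z ξ

/-- The complex Hessian form of a real function on the diagonal (which is real for `C²` functions). -/
noncomputable def hessForm (f : CC2 → ℝ) (z ξ : CC2) : ℝ :=
  (complexHessian (fun w => (f w : ℂ)) z ξ ξ).re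

/-- `f` is a (`C²`) plurisubharmonic function on the open set `V`. -/
def IsPSHOn (f : CC2 → ℝ) (V : Set CC2) : Prop :=
  ContDiffOn ℝ 2 f V ∧ ∀ z ∈ V, ∀ ξ : CC2, 0 ≤ hessForm f z ξ

/-- `f` is a (`C²`) strictly plurisubharmonic function on the open set `V`. -/
def IsStrictlyPSHOn (f : CC2 → ℝ) (V : Set CC2) : Prop :=
  ContDiffOn ℝ 2 f V ∧ ∀ z ∈ V, ∀ ξ : CC2, ξ ≠ 0 → 0 < hessForm f z ξ

/-- `r`, considered on the open set `U`, is smooth, is negative exactly on `Ω` there, and has nonzero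
differential at the boundary points of `Ω` in `U`. -/
structure DefinesOn (Ω U : Set CC2) (r : CC2 → ℝ) : Prop where
  isOpen : IsOpen U
  smooth : ContDiffOn ℝ ∞ r U
  neg_iff : ∀ z ∈ U, r z < 0 ↔ z ∈ Ω
  fderiv_ne_zero : ∀ z ∈ frontier Ω ∩ U, fderiv ℝ r z ≠ 0

/-- `r : U → ℝ` is a smooth defining function for `Ω`. -/
def IsDefiningFunction (Ω U : Set CC2) (r : CC2 → ℝ) : Prop :=
  DefinesOn Ω U r ∧ frontier Ω ⊆ U

/-- `r : U → ℝ` is a smooth local defining function for `Ω` near `p`. -/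
def IsLocalDefiningFunction (Ω : Set CC2) (p : CC2) (U : Set CC2) (r : CC2 → ℝ) : Prop :=
  DefinesOn Ω U r ∧ p ∈ U

/-- A bounded domain in `ℂ²` with smooth boundary. -/
structure IsSmoothlyBoundedDomain (Ω : Set CC2) : Prop where
  isOpen : IsOpen Ω
  isConnected : IsConnected Ω
  isBounded : Bornology.IsBounded Ω
  smooth_boundary : ∀ p ∈ frontier Ω, ∃ U r, IsLocalDefiningFunction Ω p U r

/-- Levi pseudoconvexity at every boundary point. -/
def IsPseudoconvex (Ω : Set CC2) : Prop :=
  ∀ p ∈ frontier Ω, ∃ U r, IsLocalDefiningFunction Ω p U r ∧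
    ∀ q ∈ frontier Ω ∩ U, ∀ ξ : CC2, del (fun w => (r w : ℂ)) q ξ = 0 → 0 ≤ hessForm r q ξ

/-- The iterated derivative `L_m ⋯ L_1 f` along a `(1,0)`-vector field `L` and its conjugate: the
letter `true` stands for `L`, the letter `false` for the conjugate of `L`, the last letter of the
list is applied first. -/
noncomputable def wordDeriv (L : CC2 → CC2) : List Bool → (CC2 → ℂ) → CC2 → ℂ
  | [], f => f
  | true :: w, f => fun z => del (wordDeriv L w f) z (L z)
  | false :: w, f => fun z => delbar (wordDeriv L w f) z (L z)

/-- The boundary of `Ω` is of (finite) type `k` at `p`: for a smooth local defining function `r` and a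
nonvanishing smooth tangential `(1,0)`-vector field `L` near `p`, with Levi form `λ = H_r(L, L)`,
`k` is the least integer for which some derivative `(L_{k-2} ⋯ L_1 λ)(p)`, each `L_j` being `L` or
its conjugate, is nonzero. -/
def IsOfType (Ω : Set CC2) (p : CC2) (k : ℕ) : Prop :=
  ∃ (U : Set CC2) (r : CC2 → ℝ) (L : CC2 → CC2),
    IsLocalDefiningFunction Ω p U r ∧ ContDiffOn ℝ ∞ L U ∧ (∀ q ∈ U, L q ≠ 0) ∧
    (∀ q ∈ frontier Ω ∩ U, del (fun w => (r w : ℂ)) q (L q) = 0) ∧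
    IsLeast {m : ℕ | ∃ w : List Bool, m = w.length + 2 ∧
      wordDeriv L w (fun q => complexHessian (fun w => (r w : ℂ)) q (L q) (L q)) p ≠ 0} k

/-- The exponents `η ∈ (0,1)` for which some smooth defining function `r` makes `-(-r)^η` strictly
plurisubharmonic inside `Ω` near the boundary. -/
def dfExponents (Ω : Set CC2) : Set ℝ :=
  {η | 0 < η ∧ η < 1 ∧ ∃ U r, IsDefiningFunction Ω U r ∧
    IsStrictlyPSHOn (fun z => -(-r z) ^ η) (Ω ∩ U)}

/-- The exponents `μ > 1` for which some smooth defining function `r` makes `r^μ` strictly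
plurisubharmonic outside the closure of `Ω` near the boundary. -/
def steinnessExponents (Ω : Set CC2) : Set ℝ :=
  {μ | 1 < μ ∧ ∃ U r, IsDefiningFunction Ω U r ∧
    IsStrictlyPSHOn (fun z => r z ^ μ) ((closure Ω)ᶜ ∩ U)}

/-- The Diederich–Fornæss index (`0` if there is no exponent). -/
noncomputable def dfIndex (Ω : Set CC2) : ℝ≥0∞ := ⨆ η ∈ dfExponents Ω, ENNReal.ofReal η

/-- The Steinness index (`∞` if there is no exponent). -/
noncomputable def steinnessIndex (Ω : Set CC2) : ℝ≥0∞ :=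
  ⨅ μ ∈ steinnessExponents Ω, ENNReal.ofReal μ

open Filter Topology

/-! Let `ρ` be plurisubharmonic on the boundary, `L` its complex tangential field and `λ = H_ρ(L,
L)`. Everything rests on one estimate near the boundary: for each `ε > 0` there is `C` with `H_ρ(ξ,
ξ) ≥ -ε|ρ||ξ|² - C|∂ρ(ξ)|²` (`DefinesOn.leviForm_bound_nhdsSet`). Smoothness alone would give only
some fixed constant in place of `ε`.

The gain comes from `dλ(p) = 0`, in every direction including the normal one, at each boundary point
with `λ(p) = 0` (`DefinesOn.fderiv_leviFun_eq_zero`). Since `λ ≥ 0` on the boundary, its first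
tangential derivatives vanish at `p`, so type 3 cannot occur; excluding type 4 makes the second ones
vanish too, and `λ = o(t²)` along tangential curves. Semi-definiteness on all of `ℂ²` gives `H_ρ(L,
N)² ≤ Cλ` for any `N`, so `H_ρ(L, N)` is `o(t)` on these curves. Symmetry of the third derivatives
identifies the derivative of `λ` along `N` with tangential derivatives of `H_ρ(L, N)`, which are
therefore zero. Comparing `z` with a boundary point at distance `O(|ρ(z)|)` then yields the
estimate; where `λ(p) > 0` it is elementary.

For the exponents, take `ρ e^{∓δ|z|²}`. In the Hessian of the logarithm of its modulus, the
exponential contributes `∓δ|ξ|²`, which dominates the `ε` error, and the room between the exponent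
and `1` absorbs both the `C` term and the cross terms (`leviForm_exp_logPower_neg`,
`leviForm_exp_logPower_pos`). This gives strict plurisubharmonicity, hence both indices. Solving `r
+ r² = s` for the resulting defining function `s` puts it in the form with the quadratic correction,
with `K = 1`. -/

/-- The real bilinear form whose diagonal is the complex Hessian form. -/
noncomputable def leviForm (f : CC2 → ℝ) (z ξ ζ : CC2) : ℝ :=
  (fderiv ℝ (fderiv ℝ f) z ξ ζ + fderiv ℝ (fderiv ℝ f) z (I • ξ) (I • ζ)) / 4

theorem I_smul_I_smul (ξ : CC2) : I • I • ξ = -ξ := by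
  rw [smul_smul, I_mul_I, neg_one_smul]

theorem complex_smul_eq (c : ℂ) (ξ : CC2) : c • ξ = c.re • ξ + c.im • (I • ξ) := by
  rw [← Complex.coe_smul, ← Complex.coe_smul, smul_smul, ← add_smul, re_add_im]

/-! ### The complex Hessian as a real bilinear form. -/

section Basic

variable {f g : CC2 → ℝ} {z : CC2}

theorem leviForm_add_left (ξ ξ' ζ : CC2) :
    leviForm f z (ξ + ξ') ζ = leviForm f z ξ ζ + leviForm f z ξ' ζ := by
  simp only [leviForm, smul_add, map_add, add_apply]; ring

theorem leviForm_add_right (ξ ζ ζ' : CC2) :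
    leviForm f z ξ (ζ + ζ') = leviForm f z ξ ζ + leviForm f z ξ ζ' := by
  simp only [leviForm, smul_add, map_add]; ring

theorem leviForm_smul_left (a : ℝ) (ξ ζ : CC2) :
    leviForm f z (a • ξ) ζ = a * leviForm f z ξ ζ := by
  simp only [leviForm, smul_comm I a, map_smul, smul_apply, smul_eq_mul]; ring

theorem leviForm_smul_right (a : ℝ) (ξ ζ : CC2) :
    leviForm f z ξ (a • ζ) = a * leviForm f z ξ ζ := by
  simp only [leviForm, smul_comm I a, map_smul, smul_eq_mul]; ring

theorem leviForm_I_I (ξ ζ : CC2) : leviForm f z (I • ξ) (I • ζ) = leviForm f z ξ ζ := by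
  simp only [leviForm, I_smul_I_smul, map_neg, neg_apply]; ring

theorem leviForm_I_left (ξ ζ : CC2) : leviForm f z (I • ξ) ζ = -leviForm f z ξ (I • ζ) := by
  simp only [leviForm, I_smul_I_smul, map_neg, neg_apply]; ring

theorem ContDiffAt.snd_fderiv_symm (hf : ContDiffAt ℝ 2 f z) (ξ ζ : CC2) :
    fderiv ℝ (fderiv ℝ f) z ξ ζ = fderiv ℝ (fderiv ℝ f) z ζ ξ :=
  (hf.isSymmSndFDerivAt (by simp)).eq ξ ζ

theorem leviForm_symm (hf : ContDiffAt ℝ 2 f z) (ξ ζ : CC2) :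
    leviForm f z ξ ζ = leviForm f z ζ ξ := by
  rw [leviForm, leviForm, hf.snd_fderiv_symm, hf.snd_fderiv_symm (I • ξ)]

/-- The cross terms drop out because the form is symmetric and multiplication by `I` is skew for it,
so `ξ` and `I • ξ` are orthogonal. -/
theorem leviForm_complex_smul (hf : ContDiffAt ℝ 2 f z) (c : ℂ) (ξ : CC2) :
    leviForm f z (c • ξ) (c • ξ) = ‖c‖ ^ 2 * leviForm f z ξ ξ := by
  have h1 : leviForm f z ξ (I • ξ) = 0 := by
    have h2 := leviForm_I_left (f := f) (z := z) ξ ξ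
    rw [leviForm_symm hf] at h2
    linarith
  rw [complex_smul_eq c ξ, ← Complex.normSq_eq_norm_sq, Complex.normSq_apply]
  simp only [leviForm_add_left, leviForm_add_right, leviForm_smul_left, leviForm_smul_right,
    leviForm_I_I]
  simp only [leviForm_I_left, h1]
  ring

theorem delbar_ofReal (hf : DifferentiableAt ℝ f z) (ζ : CC2) :
    delbar (fun w => (f w : ℂ)) z ζ
      = ((fderiv ℝ f z ζ : ℂ) + I * (fderiv ℝ f z (I • ζ) : ℂ)) / 2 := by
  have h : HasFDerivAt (fun w => (f w : ℂ)) (ofRealCLM.comp (fderiv ℝ f z)) z :=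
    ofRealCLM.hasFDerivAt.comp z hf.hasFDerivAt
  simp [delbar, h.fderiv]

theorem del_ofReal (hf : DifferentiableAt ℝ f z) (ζ : CC2) :
    del (fun w => (f w : ℂ)) z ζ
      = ((fderiv ℝ f z ζ : ℂ) - I * (fderiv ℝ f z (I • ζ) : ℂ)) / 2 := by
  have h : HasFDerivAt (fun w => (f w : ℂ)) (ofRealCLM.comp (fderiv ℝ f z)) z :=
    ofRealCLM.hasFDerivAt.comp z hf.hasFDerivAt
  simp [del, h.fderiv]

theorem ContDiffAt.eventually_differentiableAt {n : ℕ∞ω} (hf : ContDiffAt ℝ n f z) (hn : 2 ≤ n) :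
    ∀ᶠ w in 𝓝 z, DifferentiableAt ℝ f w := by
  filter_upwards [(hf.of_le hn).eventually (by simp)] with w hw
  exact hw.differentiableAt (by simp)

theorem ContDiffAt.differentiableAt_fderiv (hf : ContDiffAt ℝ 2 f z) :
    DifferentiableAt ℝ (fderiv ℝ f) z :=
  (hf.fderiv_right (m := 1) (by norm_num)).differentiableAt (by simp)

/-- The imaginary part cancels by symmetry of the second derivative. This links the Wirtinger
definition to the real calculus used in the rest of the argument. -/
theorem complexHessian_self (hf : ContDiffAt ℝ 2 f z) (ξ : CC2) :
    complexHessian (fun w => (f w : ℂ)) z ξ ξ = (leviForm f z ξ ξ : ℂ) := by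
  have hev : (fun w => delbar (fun w => (f w : ℂ)) w ξ) =ᶠ[𝓝 z]
      fun w => ((fderiv ℝ f w ξ : ℂ) + I * (fderiv ℝ f w (I • ξ) : ℂ)) / 2 := by
    filter_upwards [hf.eventually_differentiableAt le_rfl] with w hw
    exact delbar_ofReal hw ξ
  have hD := hf.differentiableAt_fderiv.hasFDerivAt
  have h1 (v : CC2) : HasFDerivAt (fun w => (fderiv ℝ f w v : ℂ))
      (ofRealCLM.comp ((fderiv ℝ (fderiv ℝ f) z).flip v)) z := by
    refine (ofRealCLM.hasFDerivAt.comp z (hD.clm_apply (hasFDerivAt_const v z))).congr_fderiv ?_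
    ext; simp
  have h2 := ((h1 ξ).add ((h1 (I • ξ)).const_mul I)).mul_const (1 / 2 : ℂ)
  have h3 : fderiv ℝ (fun w => delbar (fun w => (f w : ℂ)) w ξ) z = _ :=
    (h2.congr_of_eventuallyEq (hev.trans (Eventually.of_forall fun w => by
      simp [div_eq_mul_inv]))).fderiv
  rw [complexHessian, del, h3]
  have hs := hf.snd_fderiv_symm ξ (I • ξ)
  simp [leviForm, hs]
  ring_nf
  simp
  ring

theorem hessForm_eq_leviForm (hf : ContDiffAt ℝ 2 f z) (ξ : CC2) :
    hessForm f z ξ = leviForm f z ξ ξ := by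
  rw [hessForm, complexHessian_self hf, ofReal_re]

theorem Filter.EventuallyEq.leviForm_eq (h : f =ᶠ[𝓝 z] g) (ξ ζ : CC2) :
    leviForm f z ξ ζ = leviForm g z ξ ζ := by
  rw [leviForm, leviForm, h.fderiv.fderiv_eq]

end Basic

/-! ### Defining functions: signs, zero set and distance to the boundary. -/

section Boundary

variable {Ω U : Set CC2} {ρ : CC2 → ℝ} {z p : CC2}

theorem DefinesOn.contDiffAt (h : DefinesOn Ω U ρ) (hz : z ∈ U) : ContDiffAt ℝ ∞ ρ z :=
  (h.smooth z hz).contDiffAt (h.isOpen.mem_nhds hz)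

theorem DefinesOn.contDiffAt_fderiv (h : DefinesOn Ω U ρ) (hz : z ∈ U) :
    ContDiffAt ℝ ∞ (fderiv ℝ ρ) z :=
  (h.contDiffAt hz).fderiv_right (by simp)

theorem DefinesOn.contDiffAt_fderiv_fderiv (h : DefinesOn Ω U ρ) (hz : z ∈ U) :
    ContDiffAt ℝ ∞ (fderiv ℝ (fderiv ℝ ρ)) z :=
  (h.contDiffAt_fderiv hz).fderiv_right (by simp)

theorem DefinesOn.contDiffAt_two (h : DefinesOn Ω U ρ) (hz : z ∈ U) : ContDiffAt ℝ 2 ρ z :=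
  contDiffAt_infty.1 (h.contDiffAt hz) 2

theorem DefinesOn.differentiableAt (h : DefinesOn Ω U ρ) (hz : z ∈ U) : DifferentiableAt ℝ ρ z :=
  (h.contDiffAt hz).differentiableAt (by simp)

theorem DefinesOn.eventually_fderiv_ne_zero (h : DefinesOn Ω U ρ) (hp : p ∈ frontier Ω ∩ U) :
    ∀ᶠ z in 𝓝 p, fderiv ℝ ρ z ≠ 0 :=
  (h.contDiffAt_fderiv hp.2).continuousAt.eventually_ne (h.fderiv_ne_zero p hp)

theorem DefinesOn.nonneg (h : DefinesOn Ω U ρ) (hz : z ∈ U) (hz' : z ∉ Ω) : 0 ≤ ρ z :=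
  not_lt.1 fun hlt => hz' ((h.neg_iff z hz).1 hlt)

theorem DefinesOn.eq_zero (hΩ : IsOpen Ω) (h : DefinesOn Ω U ρ) (hp : p ∈ frontier Ω ∩ U) :
    ρ p = 0 := by
  obtain ⟨⟨hc, hi⟩, hU⟩ := hp
  rw [hΩ.interior_eq] at hi
  refine le_antisymm ?_ (h.nonneg hU hi)
  by_contra! hlt
  have hev := ((h.contDiffAt hU).continuousAt.eventually (lt_mem_nhds hlt)).and
    (h.isOpen.mem_nhds hU)
  obtain ⟨w, hw, hwΩ⟩ := mem_closure_iff_nhds.1 hc _ hev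
  exact absurd ((h.neg_iff w hw.2).2 hwΩ) (not_lt.2 hw.1.le)

/-- Off the closure `ρ ≥ 0`, so a point there with `ρ ≤ 0` would be a local minimum, hence critical.
-/
theorem DefinesOn.mem_closure (h : DefinesOn Ω U ρ) (hz : z ∈ U) (hD : fderiv ℝ ρ z ≠ 0)
    (h0 : ρ z ≤ 0) : z ∈ closure Ω := by
  by_contra hcl
  refine hD (IsLocalMin.fderiv_eq_zero ?_)
  filter_upwards [isClosed_closure.isOpen_compl.mem_nhds hcl, h.isOpen.mem_nhds hz] with w hw hwU
  exact h0.trans (h.nonneg hwU fun hwΩ => hw (subset_closure hwΩ))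

theorem DefinesOn.mem_frontier (hΩ : IsOpen Ω) (h : DefinesOn Ω U ρ) (hz : z ∈ U)
    (hD : fderiv ℝ ρ z ≠ 0) (h0 : ρ z = 0) : z ∈ frontier Ω := by
  refine ⟨h.mem_closure hz hD h0.le, ?_⟩
  rw [hΩ.interior_eq, ← h.neg_iff z hz, h0]
  exact lt_irrefl 0

theorem DefinesOn.pos (h : DefinesOn Ω U ρ) (hz : z ∈ U) (hD : fderiv ℝ ρ z ≠ 0)
    (hcl : z ∉ closure Ω) : 0 < ρ z := by
  by_contra! h0
  exact hcl (h.mem_closure hz hD h0)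

/-- The distance to the boundary is controlled by any defining function. -/
theorem DefinesOn.exists_frontier_near (hΩ : IsOpen Ω) (h : DefinesOn Ω U ρ)
    (hp : p ∈ frontier Ω ∩ U) :
    ∃ C > 0, ∀ᶠ z in 𝓝 p, ∃ q ∈ frontier Ω, ‖z - q‖ ≤ C * |ρ z| := by
  obtain ⟨n, hn⟩ : ∃ n, fderiv ℝ ρ p n = 1 := by
    obtain ⟨m, hm⟩ : ∃ m, fderiv ℝ ρ p m ≠ 0 := by
      by_contra! hm
      exact h.fderiv_ne_zero p hp (ContinuousLinearMap.ext hm)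
    exact ⟨(fderiv ℝ ρ p m)⁻¹ • m, by simp [hm]⟩
  have hcont : ContinuousAt (fun z => fderiv ℝ ρ z n) p :=
    (h.contDiffAt_fderiv hp.2).continuousAt.clm_apply continuousAt_const
  have hev : ∀ᶠ z in 𝓝 p, z ∈ U ∧ fderiv ℝ ρ z ≠ 0 ∧ 1 / 2 < fderiv ℝ ρ z n := by
    filter_upwards [h.isOpen.mem_nhds hp.2, h.eventually_fderiv_ne_zero hp,
      hcont.eventually (lt_mem_nhds (show 1 / 2 < fderiv ℝ ρ p n by rw [hn]; norm_num))]
      with z h1 h2 h3 using ⟨h1, h2, h3⟩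
  obtain ⟨δ, hδ, hball⟩ := Metric.eventually_nhds_iff_ball.1 hev
  refine ⟨2 * ‖n‖ + 1, by positivity, ?_⟩
  have hρ0 : Tendsto (fun z => 2 * |ρ z| * ‖n‖) (𝓝 p) (𝓝 0) := by
    have : ContinuousAt (fun z => 2 * |ρ z| * ‖n‖) p :=
      (continuousAt_const.mul (h.contDiffAt hp.2).continuousAt.abs).mul continuousAt_const
    simpa [ContinuousAt, h.eq_zero hΩ hp] using this
  filter_upwards [Metric.ball_mem_nhds p (half_pos hδ),
    hρ0.eventually (gt_mem_nhds (half_pos hδ))] with z hz hsmall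
  -- Along `n` the slope of `ρ` exceeds `1/2`, so moving by at most `2|ρ z|` is enough to reach the
  -- zero set.
  set T := 2 * |ρ z| with hT
  have hT0 : 0 ≤ T := by positivity
  have hmem : ∀ t ∈ Icc (-T) T, z + t • n ∈ Metric.ball p δ := by
    intro t ht
    have h1 : ‖t • n‖ ≤ T * ‖n‖ := by
      rw [norm_smul]
      exact mul_le_mul_of_nonneg_right (abs_le.2 ht) (norm_nonneg n)
    rw [Metric.mem_ball, dist_eq_norm] at hz ⊢
    calc ‖z + t • n - p‖ = ‖(z - p) + t • n‖ := by congr 1; abel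
      _ ≤ ‖z - p‖ + ‖t • n‖ := norm_add_le _ _
      _ < δ := by linarith
  have hder : ∀ t ∈ Icc (-T) T, HasDerivAt (fun t : ℝ => ρ (z + t • n))
      (fderiv ℝ ρ (z + t • n) n) t := by
    intro t ht
    have h1 : HasDerivAt (fun t : ℝ => z + t • n) n t := by
      simpa using ((hasDerivAt_id t).smul_const n).const_add z
    exact (h.differentiableAt (hball _ (hmem t ht)).1).hasFDerivAt.comp_hasDerivAt t h1
  have hcontu : ContinuousOn (fun t : ℝ => ρ (z + t • n)) (Icc (-T) T) := fun t ht =>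
    (hder t ht).continuousAt.continuousWithinAt
  have hmvt : ∀ x ∈ Icc (-T) T, ∀ y ∈ Icc (-T) T, x ≤ y →
      1 / 2 * (y - x) ≤ ρ (z + y • n) - ρ (z + x • n) := by
    refine (convex_Icc (-T) T).mul_sub_le_image_sub_of_le_deriv hcontu
      (fun t ht => (hder t (interior_subset ht)).differentiableAt.differentiableWithinAt) ?_
    intro t ht
    rw [(hder t (interior_subset ht)).deriv]
    exact (hball _ (hmem t (interior_subset ht))).2.2.le
  have h0 : (0 : ℝ) ∈ Icc (-T) T := ⟨by linarith, hT0⟩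
  have hl : (-T) ∈ Icc (-T) T := ⟨le_rfl, by linarith⟩
  have hr : T ∈ Icc (-T) T := ⟨by linarith, le_rfl⟩
  have h1 := hmvt _ hl _ h0 h0.1
  have h2 := hmvt _ h0 _ hr h0.2
  simp only [zero_smul, add_zero] at h1 h2
  have h3 := neg_abs_le (ρ z)
  have h4 := le_abs_self (ρ z)
  obtain ⟨t, ht, hρt⟩ := intermediate_value_Icc (by linarith : -T ≤ T) hcontu
    (show (0 : ℝ) ∈ Icc (ρ (z + (-T) • n)) (ρ (z + T • n)) from ⟨by linarith, by linarith⟩)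
  have hb := hball _ (hmem t ht)
  refine ⟨z + t • n, h.mem_frontier hΩ hb.1 hb.2.1 hρt, ?_⟩
  rw [sub_add_cancel_left, norm_neg, norm_smul, Real.norm_eq_abs]
  have := mul_le_mul_of_nonneg_right (abs_le.2 ht) (norm_nonneg n)
  nlinarith [abs_nonneg (ρ z)]

end Boundary

/-! ### The form `∂f` and its kernel. -/

section TangentField

variable {f : CC2 → ℝ} {z : CC2}

/-- The `(1,0)`-form `∂f` of a real function. -/
noncomputable def delForm (f : CC2 → ℝ) (z ξ : CC2) : ℂ :=
  ((fderiv ℝ f z ξ : ℂ) - I * (fderiv ℝ f z (I • ξ) : ℂ)) / 2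

theorem delForm_re (ξ : CC2) : (delForm f z ξ).re = fderiv ℝ f z ξ / 2 := by
  simp [delForm]

theorem delForm_im (ξ : CC2) : (delForm f z ξ).im = -fderiv ℝ f z (I • ξ) / 2 := by
  simp [delForm]

theorem delForm_eq_zero_iff (ξ : CC2) :
    delForm f z ξ = 0 ↔ fderiv ℝ f z ξ = 0 ∧ fderiv ℝ f z (I • ξ) = 0 := by
  simp [Complex.ext_iff, delForm_re, delForm_im]

theorem norm_sq_delForm (ξ : CC2) :
    ‖delForm f z ξ‖ ^ 2 = ((fderiv ℝ f z ξ) ^ 2 + (fderiv ℝ f z (I • ξ)) ^ 2) / 4 := by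
  rw [← normSq_eq_norm_sq, normSq_apply, delForm_re, delForm_im]; ring

theorem delForm_add (ξ ζ : CC2) : delForm f z (ξ + ζ) = delForm f z ξ + delForm f z ζ := by
  simp only [delForm, smul_add, map_add, ofReal_add]; ring

theorem delForm_smul (c : ℂ) (ξ : CC2) : delForm f z (c • ξ) = c * delForm f z ξ := by
  rw [delForm, smul_smul, mul_comm I c, ← smul_smul, complex_smul_eq c ξ,
    complex_smul_eq c (I • ξ), I_smul_I_smul]
  apply Complex.ext <;> simp [delForm] <;> ring

/-- The standard basis vectors of `ℂ²`. -/
noncomputable abbrev stdVec (j : Fin 2) : CC2 := EuclideanSpace.single j 1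

theorem eq_stdVec_combination (ξ : CC2) : ξ = ξ 0 • stdVec 0 + ξ 1 • stdVec 1 := by
  ext j; fin_cases j <;> simp

theorem delForm_eq (ξ : CC2) :
    delForm f z ξ = ξ 0 * delForm f z (stdVec 0) + ξ 1 * delForm f z (stdVec 1) := by
  conv_lhs => rw [eq_stdVec_combination ξ]
  rw [delForm_add, delForm_smul, delForm_smul]

/-- The complex tangential field of the level sets of `f`. -/
noncomputable def tangentField (f : CC2 → ℝ) (z : CC2) : CC2 :=
  delForm f z (stdVec 1) • stdVec 0 - delForm f z (stdVec 0) • stdVec 1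

theorem delForm_tangentField : delForm f z (tangentField f z) = 0 := by
  rw [delForm_eq]; simp [tangentField]; ring

theorem delForm_stdVec_ne_zero (h : fderiv ℝ f z ≠ 0) :
    delForm f z (stdVec 0) ≠ 0 ∨ delForm f z (stdVec 1) ≠ 0 := by
  by_contra! hc
  refine h (ContinuousLinearMap.ext fun ξ => ?_)
  have h0 : delForm f z ξ = 0 := by rw [delForm_eq, hc.1, hc.2]; simp
  exact ((delForm_eq_zero_iff ξ).1 h0).1

theorem tangentField_ne_zero (h : fderiv ℝ f z ≠ 0) : tangentField f z ≠ 0 := by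
  intro h0
  have e0 := congrArg (fun v : CC2 => v 0) h0
  have e1 := congrArg (fun v : CC2 => v 1) h0
  simp [tangentField] at e0 e1
  exact (delForm_stdVec_ne_zero h).elim (· e1) (· e0)

/-- The kernel of a nonzero linear form on `ℂ²` is a line; dimension two enters here. -/
theorem exists_eq_smul_tangentField (h : fderiv ℝ f z ≠ 0) {ξ : CC2} (hξ : delForm f z ξ = 0) :
    ∃ c : ℂ, ξ = c • tangentField f z := by
  rw [delForm_eq] at hξ
  rcases delForm_stdVec_ne_zero h with h0 | h1
  · refine ⟨-(ξ 1 / delForm f z (stdVec 0)), ?_⟩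
    ext j; fin_cases j
    · simp [tangentField]; field_simp; linear_combination hξ
    · simp [tangentField]; field_simp
  · refine ⟨ξ 0 / delForm f z (stdVec 1), ?_⟩
    ext j; fin_cases j
    · simp [tangentField]; field_simp
    · simp [tangentField]; field_simp; linear_combination hξ

theorem exists_delForm_eq_one (h : fderiv ℝ f z ≠ 0) : ∃ ξ, delForm f z ξ = 1 := by
  rcases delForm_stdVec_ne_zero h with h0 | h1
  · exact ⟨(delForm f z (stdVec 0))⁻¹ • stdVec 0, by rw [delForm_smul, inv_mul_cancel₀ h0]⟩
  · exact ⟨(delForm f z (stdVec 1))⁻¹ • stdVec 1, by rw [delForm_smul, inv_mul_cancel₀ h1]⟩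

theorem contDiffAt_delForm {n : ℕ∞ω} (h : ContDiffAt ℝ n (fderiv ℝ f) z) (ξ : CC2) :
    ContDiffAt ℝ n (fun w => delForm f w ξ) z := by
  have h1 (v : CC2) : ContDiffAt ℝ n (fun w => (fderiv ℝ f w v : ℂ)) z :=
    ofRealCLM.contDiff.contDiffAt.comp z (h.clm_apply contDiffAt_const)
  exact ((h1 ξ).sub (contDiffAt_const.mul (h1 _))).div_const 2

theorem contDiffAt_tangentField {n : ℕ∞ω} (h : ContDiffAt ℝ n (fderiv ℝ f) z) :
    ContDiffAt ℝ n (tangentField f) z :=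
  ((contDiffAt_delForm h _).smul contDiffAt_const).sub
    ((contDiffAt_delForm h _).smul contDiffAt_const)

end TangentField

/-! ### Tangential derivatives through integral curves in the boundary. -/

section Curves

/-- A function vanishing to second order in the sense of derivatives is `o(t²)`. -/
theorem isLittleO_sq_of_hasDerivAt {g φ : ℝ → ℝ} (hg : ∀ᶠ t in 𝓝 0, HasDerivAt g (φ t) t)
    (hg0 : g 0 = 0) (hφ0 : φ 0 = 0) (hφ : HasDerivAt φ 0 0) :
    g =o[𝓝 0] fun t => t ^ 2 := by
  rw [Asymptotics.isLittleO_iff]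
  intro ε hε
  have h1 : ∀ᶠ t in 𝓝 (0 : ℝ), ‖φ t‖ ≤ ε * ‖t‖ := by
    have := (hasDerivAt_iff_isLittleO.1 hφ).def hε
    simpa [hφ0] using this
  obtain ⟨δ, hδ, hball⟩ := Metric.eventually_nhds_iff_ball.1 (hg.and h1)
  filter_upwards [Metric.ball_mem_nhds 0 hδ] with t ht
  have hsub : ∀ s ∈ Metric.closedBall (0 : ℝ) ‖t‖, s ∈ Metric.ball (0 : ℝ) δ := by
    intro s hs
    rw [mem_closedBall_zero_iff] at hs
    rw [mem_ball_zero_iff] at ht ⊢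
    exact hs.trans_lt ht
  have := (convex_closedBall (0 : ℝ) ‖t‖).norm_image_sub_le_of_norm_hasDerivWithin_le
    (f := g) (f' := φ) (C := ε * ‖t‖)
    (fun s hs => (hball s (hsub s hs)).1.hasDerivWithinAt)
    (fun s hs => (hball s (hsub s hs)).2.trans
      (mul_le_mul_of_nonneg_left (mem_closedBall_zero_iff.1 hs) hε.le))
    (x := 0) (y := t) (by simp) (by simp)
  simpa [hg0, pow_two, mul_assoc] using this

variable {Ω U : Set CC2} {ρ : CC2 → ℝ} {p : CC2}

/-- A field annihilating `dρ` on every level set keeps `ρ` constant along its flow, so a curve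
starting on the boundary stays there. Boundary inequalities thus become one-variable ones. -/
theorem DefinesOn.exists_integralCurve (hΩ : IsOpen Ω) (h : DefinesOn Ω U ρ)
    (hp : p ∈ frontier Ω ∩ U) {V : CC2 → CC2} (hV : ContDiffAt ℝ 1 V p)
    (hVρ : ∀ z, fderiv ℝ ρ z (V z) = 0) :
    ∃ γ : ℝ → CC2, γ 0 = p ∧
      ∀ᶠ t in 𝓝 (0 : ℝ), HasDerivAt γ (V (γ t)) t ∧ γ t ∈ frontier Ω ∩ U := by
  obtain ⟨γ, hγ0, ε, hε, hγ⟩ :=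
    hV.exists_forall_mem_closedBall_exists_eq_forall_mem_Ioo_hasDerivAt₀ 0
  refine ⟨γ, hγ0, ?_⟩
  have hγ0' : ∀ᶠ t in 𝓝 (0 : ℝ), HasDerivAt γ (V (γ t)) t := by
    filter_upwards [Ioo_mem_nhds (by linarith : 0 - ε < 0) (by linarith : 0 < 0 + ε)] with t ht
      using hγ t ht
  have hcont : ContinuousAt γ 0 := hγ0'.self_of_nhds.continuousAt
  have hev : ∀ᶠ t in 𝓝 (0 : ℝ), γ t ∈ U ∧ fderiv ℝ ρ (γ t) ≠ 0 := by
    have h1 : ∀ᶠ z in 𝓝 (γ 0), z ∈ U ∧ fderiv ℝ ρ z ≠ 0 := by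
      rw [hγ0]
      filter_upwards [h.isOpen.mem_nhds hp.2, h.eventually_fderiv_ne_zero hp] with z a b
        using ⟨a, b⟩
    exact hcont.eventually h1
  obtain ⟨δ, hδ, hball⟩ := Metric.eventually_nhds_iff_ball.1 (hγ0'.and hev)
  have hder : ∀ t ∈ Metric.ball (0 : ℝ) δ, HasDerivAt (fun t => ρ (γ t)) 0 t := by
    intro t ht
    have := (h.differentiableAt (hball t ht).2.1).hasFDerivAt.comp_hasDerivAt t (hball t ht).1
    rwa [hVρ] at this
  filter_upwards [Metric.ball_mem_nhds 0 hδ] with t ht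
  have hconst : ρ (γ t) = ρ (γ 0) :=
    Metric.isOpen_ball.is_const_of_deriv_eq_zero (convex_ball (0 : ℝ) δ).isPreconnected
      (fun s hs => (hder s hs).differentiableAt.differentiableWithinAt)
      (fun s hs => (hder s hs).deriv) ht (Metric.mem_ball_self hδ)
  rw [hγ0, h.eq_zero hΩ hp] at hconst
  exact ⟨(hball t ht).1, h.mem_frontier hΩ (hball t ht).2.1 (hball t ht).2.2 hconst,
    (hball t ht).2.1⟩

/-- First order condition at a boundary minimum, in a tangential direction. -/
theorem DefinesOn.fderiv_eq_zero_of_nonneg (hΩ : IsOpen Ω) (h : DefinesOn Ω U ρ)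
    (hp : p ∈ frontier Ω ∩ U) {V : CC2 → CC2} (hV : ContDiffAt ℝ 1 V p)
    (hVρ : ∀ z, fderiv ℝ ρ z (V z) = 0) {g : CC2 → ℝ} (hg : DifferentiableAt ℝ g p)
    (hg0 : g p = 0) (hnonneg : ∀ z ∈ frontier Ω ∩ U, 0 ≤ g z) : fderiv ℝ g p (V p) = 0 := by
  obtain ⟨γ, hγ0, hγ⟩ := h.exists_integralCurve hΩ hp hV hVρ
  subst hγ0
  have hmin : IsLocalMin (fun t => g (γ t)) 0 := by
    filter_upwards [hγ] with t ht
    rw [hg0]; exact hnonneg _ ht.2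
  exact hmin.hasDerivAt_eq_zero (hg.hasFDerivAt.comp_hasDerivAt 0 hγ.self_of_nhds.1)

/-- If `g ≥ 0` vanishes at `p` to second order along a tangential field, then so does to first
order every `k` with `k² ≤ C g` on the boundary. -/
theorem DefinesOn.fderiv_eq_zero_of_sq_le (hΩ : IsOpen Ω) (h : DefinesOn Ω U ρ)
    (hp : p ∈ frontier Ω ∩ U) {V : CC2 → CC2} (hV : ContDiffAt ℝ 1 V p)
    (hVρ : ∀ z, fderiv ℝ ρ z (V z) = 0) {g k : CC2 → ℝ} (hg : ContDiffAt ℝ 2 g p)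
    (hk : DifferentiableAt ℝ k p) (hg0 : g p = 0) (hnonneg : ∀ z ∈ frontier Ω ∩ U, 0 ≤ g z)
    (hg2 : fderiv ℝ (fun z => fderiv ℝ g z (V z)) p (V p) = 0) {C : ℝ}
    (hkg : ∀ᶠ z in 𝓝 p, z ∈ frontier Ω → k z ^ 2 ≤ C * g z) : fderiv ℝ k p (V p) = 0 := by
  have hg1 := h.fderiv_eq_zero_of_nonneg hΩ hp hV hVρ (hg.differentiableAt (by simp)) hg0 hnonneg
  obtain ⟨γ, hγ0, hγ⟩ := h.exists_integralCurve hΩ hp hV hVρ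
  subst hγ0
  have hγd := hγ.self_of_nhds.1
  have hcont := hγd.continuousAt
  have hgd : ∀ᶠ t in 𝓝 (0 : ℝ),
      HasDerivAt (fun t => g (γ t)) (fderiv ℝ g (γ t) (V (γ t))) t := by
    filter_upwards [hγ, hcont.eventually (hg.eventually_differentiableAt le_rfl)] with t ht hd
    exact hd.hasFDerivAt.comp_hasDerivAt t ht.1
  have hφ : HasDerivAt (fun t => fderiv ℝ g (γ t) (V (γ t))) 0 0 := by
    have hd : DifferentiableAt ℝ (fun z => fderiv ℝ g z (V z)) (γ 0) :=
      hg.differentiableAt_fderiv.clm_apply (hV.differentiableAt (by simp))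
    have := hd.hasFDerivAt.comp_hasDerivAt 0 hγd
    rwa [hg2] at this
  have hlo := isLittleO_sq_of_hasDerivAt hgd hg0 hg1 hφ
  have hlo2 : (fun t => k (γ t) ^ 2) =o[𝓝 0] fun t : ℝ => t ^ 2 := by
    refine Asymptotics.IsBigO.trans_isLittleO (Asymptotics.IsBigO.of_bound |C| ?_) hlo
    filter_upwards [hγ, hcont.eventually hkg] with t ht hle
    rw [Real.norm_of_nonneg (sq_nonneg _), Real.norm_of_nonneg (hnonneg _ ht.2)]
    exact (hle ht.2.1).trans (mul_le_mul_of_nonneg_right (le_abs_self C) (hnonneg _ ht.2))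
  -- From `k² ≤ C g = o(t²)` follows `k = o(t)`, which is a vanishing derivative.
  have hlo1 : (fun t => k (γ t)) =o[𝓝 0] fun t : ℝ => t := hlo2.of_pow two_ne_zero
  have hk0 : k (γ 0) = 0 := by
    have := hkg.self_of_nhds hp.1
    rw [hg0, mul_zero] at this
    exact pow_eq_zero_iff two_ne_zero |>.1 (le_antisymm this (sq_nonneg _))
  have hkd : HasDerivAt (fun t => k (γ t)) 0 0 := by
    rw [hasDerivAt_iff_isLittleO]
    simpa [hk0] using hlo1
  exact (hk.hasFDerivAt.comp_hasDerivAt 0 hγd).unique hkd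

end Curves

/-! ### Derivatives along `L` and its conjugate in real terms. -/

section Words

variable {L : CC2 → CC2} {g : CC2 → ℝ} {p : CC2}

theorem wordDeriv_congr {f f' : CC2 → ℂ} (h : f =ᶠ[𝓝 p] f') (w : List Bool) :
    wordDeriv L w f =ᶠ[𝓝 p] wordDeriv L w f' := by
  induction w with
  | nil => exact h
  | cons b w ih =>
    have h1 := ih.fderiv (𝕜 := ℝ)
    cases b <;>
    · filter_upwards [h1] with z hz
      simp only [wordDeriv, del, delbar, hz]

theorem wordDeriv_true (hg : DifferentiableAt ℝ g p) :
    wordDeriv L [true] (fun z => (g z : ℂ)) p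
      = ((fderiv ℝ g p (L p) : ℂ) - I * (fderiv ℝ g p (I • L p) : ℂ)) / 2 :=
  del_ofReal hg _

theorem wordDeriv_false (hg : DifferentiableAt ℝ g p) :
    wordDeriv L [false] (fun z => (g z : ℂ)) p
      = ((fderiv ℝ g p (L p) : ℂ) + I * (fderiv ℝ g p (I • L p) : ℂ)) / 2 :=
  delbar_ofReal hg _

/-- With `X`, `Y` the real derivatives along `L` and `I • L`, the two words have real parts `(XX -
YY)g / 4` and `(XX + YY)g / 4`; the commutator of `X` and `Y` enters only the imaginary part. -/
theorem fderiv_eq_zero_of_wordDeriv (hg : ContDiffAt ℝ 2 g p) (hL : DifferentiableAt ℝ L p)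
    (htt : wordDeriv L [true, true] (fun z => (g z : ℂ)) p = 0)
    (hft : wordDeriv L [false, true] (fun z => (g z : ℂ)) p = 0) :
    fderiv ℝ (fun z => fderiv ℝ g z (L z)) p (L p) = 0 ∧
      fderiv ℝ (fun z => fderiv ℝ g z (I • L z)) p (I • L p) = 0 := by
  have hev : wordDeriv L [true] (fun z => (g z : ℂ)) =ᶠ[𝓝 p]
      fun z => ((fderiv ℝ g z (L z) : ℂ) - I * (fderiv ℝ g z (I • L z) : ℂ)) * (1 / 2) := by
    filter_upwards [hg.eventually_differentiableAt le_rfl] with z hz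
    rw [wordDeriv_true hz]; ring
  have hA : DifferentiableAt ℝ (fun z => fderiv ℝ g z (L z)) p :=
    hg.differentiableAt_fderiv.clm_apply hL
  have hB : DifferentiableAt ℝ (fun z => fderiv ℝ g z (I • L z)) p :=
    hg.differentiableAt_fderiv.clm_apply (hL.const_smul I)
  have hA' : HasFDerivAt (fun z => (fderiv ℝ g z (L z) : ℂ)) _ p :=
    ofRealCLM.hasFDerivAt.comp p hA.hasFDerivAt
  have hB' : HasFDerivAt (fun z => (fderiv ℝ g z (I • L z) : ℂ)) _ p :=
    ofRealCLM.hasFDerivAt.comp p hB.hasFDerivAt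
  have h3 := (((hA'.sub (hB'.const_mul I)).mul_const (1 / 2 : ℂ)).congr_of_eventuallyEq hev).fderiv
  simp only [wordDeriv, del, delbar] at htt hft
  simp only [wordDeriv, del] at h3
  rw [h3] at htt hft
  have e1 := congrArg re htt
  have e2 := congrArg re hft
  simp at e1 e2
  constructor <;> linarith

end Words

/-! ### Product rule for the Levi form and symmetry of third derivatives. -/

section Product

variable {f : CC2 → ℝ} {p : CC2}

theorem hasFDerivAt_leviForm_apply (hf : ContDiffAt ℝ 3 f p) {A B : CC2 → CC2}
    {A' B' : CC2 →L[ℝ] CC2} (hA : HasFDerivAt A A' p) (hB : HasFDerivAt B B' p) (u : CC2) :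
    fderiv ℝ (fun z => leviForm f z (A z) (B z)) p u
      = (fderiv ℝ (fderiv ℝ (fderiv ℝ f)) p u (A p) (B p)
          + fderiv ℝ (fderiv ℝ (fderiv ℝ f)) p u (I • A p) (I • B p)) / 4
        + leviForm f p (A' u) (B p) + leviForm f p (A p) (B' u) := by
  have hD := (((hf.fderiv_right (m := 2) (by norm_num)).fderiv_right (m := 1)
    (by norm_num)).differentiableAt (by simp)).hasFDerivAt
  have h := (((hD.clm_apply hA).clm_apply hB).add
    ((hD.clm_apply (hA.const_smul I)).clm_apply (hB.const_smul I))).mul_const (1 / 4 : ℝ)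
  have h' : fderiv ℝ (fun z => leviForm f z (A z) (B z)) p = _ :=
    (h.congr_of_eventuallyEq (Eventually.of_forall fun z => by
      simp [leviForm, div_eq_mul_inv])).fderiv
  rw [h']
  simp [leviForm]
  ring

theorem ContDiffAt.leviForm_apply {n : ℕ∞ω}
    (hD : ContDiffAt ℝ n (fderiv ℝ (fderiv ℝ f)) p) {A B : CC2 → CC2}
    (hA : ContDiffAt ℝ n A p) (hB : ContDiffAt ℝ n B p) :
    ContDiffAt ℝ n (fun z => leviForm f z (A z) (B z)) p :=
  (((hD.clm_apply hA).clm_apply hB).add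
    ((hD.clm_apply (hA.const_smul I)).clm_apply (hB.const_smul I))).div_const 4

theorem ContDiffAt.third_fderiv_symm (hf : ContDiffAt ℝ 3 f p) (u ξ ζ : CC2) :
    fderiv ℝ (fderiv ℝ (fderiv ℝ f)) p u ξ ζ = fderiv ℝ (fderiv ℝ (fderiv ℝ f)) p ξ u ζ := by
  have h : ContDiffAt ℝ 2 (fderiv ℝ f) p := hf.fderiv_right (by norm_num)
  rw [(h.isSymmSndFDerivAt (by simp)).eq u ξ]

theorem ContDiffAt.third_fderiv_symm' (hf : ContDiffAt ℝ 3 f p) (u ξ ζ : CC2) :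
    fderiv ℝ (fderiv ℝ (fderiv ℝ f)) p u ξ ζ = fderiv ℝ (fderiv ℝ (fderiv ℝ f)) p u ζ ξ := by
  have hD := (((hf.fderiv_right (m := 2) (by norm_num)).fderiv_right (m := 1)
    (by norm_num)).differentiableAt (by simp)).hasFDerivAt
  have key (ξ ζ : CC2) := (hD.clm_apply (hasFDerivAt_const ξ p)).clm_apply (hasFDerivAt_const ζ p)
  have hev : (fun z => fderiv ℝ (fderiv ℝ f) z ξ ζ) =ᶠ[𝓝 p]
      fun z => fderiv ℝ (fderiv ℝ f) z ζ ξ := by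
    filter_upwards [hf.eventually (by simp)] with z hz
    exact (hz.of_le (by norm_num)).snd_fderiv_symm ξ ζ
  have h := ((key ζ ξ).congr_of_eventuallyEq hev).unique (key ξ ζ)
  have := congrArg (fun T : CC2 →L[ℝ] ℝ => T u) h
  simpa using this.symm

end Product

/-! ### Stationarity of the Levi function at weakly pseudoconvex points. -/

section WeaklyPseudoconvex

variable {Ω U : Set CC2} {ρ : CC2 → ℝ} {p : CC2}

/-- Cauchy–Schwarz for a semi-definite form, via the discriminant. Semi-definiteness in all
directions, not only tangential ones, is what controls the mixed terms. -/
theorem leviForm_sq_le (hf : ContDiffAt ℝ 2 ρ p) (hpsd : ∀ ξ, 0 ≤ leviForm ρ p ξ ξ) (ξ ζ : CC2) :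
    leviForm ρ p ξ ζ ^ 2 ≤ leviForm ρ p ξ ξ * leviForm ρ p ζ ζ := by
  have h : ∀ t : ℝ, 0 ≤ leviForm ρ p ξ ξ * (t * t) + 2 * leviForm ρ p ξ ζ * t
      + leviForm ρ p ζ ζ := by
    intro t
    have := hpsd (t • ξ + ζ)
    simp only [leviForm_add_left, leviForm_add_right, leviForm_smul_left,
      leviForm_smul_right, leviForm_symm hf ζ ξ] at this
    linarith
  have := discrim_le_zero h
  rw [discrim] at this
  linarith

theorem leviForm_eq_zero_of_self (hf : ContDiffAt ℝ 2 ρ p) (hpsd : ∀ ξ, 0 ≤ leviForm ρ p ξ ξ)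
    {ξ : CC2} (h0 : leviForm ρ p ξ ξ = 0) (ζ : CC2) : leviForm ρ p ξ ζ = 0 := by
  have := leviForm_sq_le hf hpsd ξ ζ
  rw [h0, zero_mul] at this
  exact pow_eq_zero_iff two_ne_zero |>.1 (le_antisymm this (sq_nonneg _))

theorem fderiv_tangentField (f : CC2 → ℝ) (z : CC2) : fderiv ℝ f z (tangentField f z) = 0 :=
  ((delForm_eq_zero_iff _).1 delForm_tangentField).1

theorem fderiv_I_smul_tangentField (f : CC2 → ℝ) (z : CC2) :
    fderiv ℝ f z (I • tangentField f z) = 0 :=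
  ((delForm_eq_zero_iff _).1 delForm_tangentField).2

/-- The Levi function of `ρ` along its tangential field. -/
noncomputable def leviFun (ρ : CC2 → ℝ) (z : CC2) : ℝ :=
  leviForm ρ z (tangentField ρ z) (tangentField ρ z)

theorem DefinesOn.contDiffAt_tangentField (h : DefinesOn Ω U ρ) (hp : p ∈ U) :
    ContDiffAt ℝ ∞ (tangentField ρ) p :=
  _root_.contDiffAt_tangentField (h.contDiffAt_fderiv hp)

theorem DefinesOn.contDiffAt_leviFun (h : DefinesOn Ω U ρ) (hp : p ∈ U) :
    ContDiffAt ℝ ∞ (leviFun ρ) p :=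
  ContDiffAt.leviForm_apply (h.contDiffAt_fderiv_fderiv hp) (h.contDiffAt_tangentField hp)
    (h.contDiffAt_tangentField hp)

theorem DefinesOn.contDiffAt_three (h : DefinesOn Ω U ρ) (hz : p ∈ U) : ContDiffAt ℝ 3 ρ p :=
  contDiffAt_infty.1 (h.contDiffAt hz) 3

/-- The shrunken domain on which the tangential field does not vanish. -/
theorem DefinesOn.inter_fderiv_ne_zero (h : DefinesOn Ω U ρ) :
    DefinesOn Ω (U ∩ {z | fderiv ℝ ρ z ≠ 0}) ρ where
  isOpen := by
    rw [isOpen_iff_mem_nhds]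
    rintro z ⟨hz, hD⟩
    filter_upwards [h.isOpen.mem_nhds hz, (h.contDiffAt_fderiv hz).continuousAt.eventually_ne hD]
      with w h1 h2 using ⟨h1, h2⟩
  smooth := h.smooth.mono inter_subset_left
  neg_iff := fun z hz => h.neg_iff z hz.1
  fderiv_ne_zero := fun z hz => h.fderiv_ne_zero z ⟨hz.1, hz.2.1⟩

/-- At a weakly pseudoconvex boundary point which is not of type `4`, the words of length two in
the tangential field annihilate the Levi function. -/
theorem DefinesOn.wordDeriv_leviFun_eq_zero (hΩ : IsOpen Ω) (h : DefinesOn Ω U ρ)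
    (hpsh : ∀ q ∈ frontier Ω ∩ U, ∀ ξ, 0 ≤ leviForm ρ q ξ ξ) (hp : p ∈ frontier Ω ∩ U)
    (htype : ¬ IsOfType Ω p 4) (h0 : leviFun ρ p = 0) {w : List Bool} (hw : w.length = 2) :
    wordDeriv (tangentField ρ) w (fun z => (leviFun ρ z : ℂ)) p = 0 := by
  -- Minimality of `4` requires the shorter words to vanish: `leviFun ρ` is zero at `p` and has a
  -- minimum there along the boundary.
  have hw1 : ∀ w : List Bool, w.length < 2 →
      wordDeriv (tangentField ρ) w (fun z => (leviFun ρ z : ℂ)) p = 0 := by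
    have hd : DifferentiableAt ℝ (leviFun ρ) p :=
      (h.contDiffAt_leviFun hp.2).differentiableAt (by simp)
    have hL : ContDiffAt ℝ 1 (tangentField ρ) p :=
      contDiffAt_infty.1 (h.contDiffAt_tangentField hp.2) 1
    have hnn : ∀ z ∈ frontier Ω ∩ U, 0 ≤ leviFun ρ z := fun z hz => hpsh z hz _
    have h1 := h.fderiv_eq_zero_of_nonneg hΩ hp hL (fderiv_tangentField ρ) hd h0 hnn
    have h2 := h.fderiv_eq_zero_of_nonneg hΩ hp (hL.const_smul I)
      (fderiv_I_smul_tangentField ρ) hd h0 hnn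
    intro w hw
    match w with
    | [] => simp [wordDeriv, h0]
    | [true] => rw [wordDeriv_true hd, h1, h2]; simp
    | [false] => rw [wordDeriv_false hd, h1, h2]; simp
  by_contra hne
  -- A nonzero word of length two would make the type exactly `4`. The domain is shrunk because the
  -- field must be nonvanishing on all of it.
  refine htype ⟨_, ρ, tangentField ρ, ⟨h.inter_fderiv_ne_zero, hp.2, h.fderiv_ne_zero p hp⟩,
    fun z hz => (h.contDiffAt_tangentField hz.1).contDiffWithinAt,
    fun q hq => tangentField_ne_zero hq.2, ?_, ?_⟩
  · intro q hq
    rw [del_ofReal (h.differentiableAt hq.2.1)]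
    exact delForm_tangentField
  · have hcongr : (fun q => complexHessian (fun w => (ρ w : ℂ)) q (tangentField ρ q)
        (tangentField ρ q)) =ᶠ[𝓝 p] fun z => (leviFun ρ z : ℂ) := by
      filter_upwards [h.isOpen.mem_nhds hp.2] with z hz
      exact complexHessian_self (h.contDiffAt_two hz) _
    have hval (w : List Bool) := (wordDeriv_congr (L := tangentField ρ) hcongr w).self_of_nhds
    refine ⟨⟨w, by rw [hw], ?_⟩, ?_⟩
    · rwa [hval]
    · rintro m ⟨w', rfl, hw'⟩
      by_contra! hlt
      rw [hval] at hw'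
      exact hw' (hw1 w' (by omega))

/-- At a weakly pseudoconvex boundary point which is not of type `4`, the Levi function is
stationary, in all directions. -/
theorem DefinesOn.fderiv_leviFun_eq_zero (hΩ : IsOpen Ω) (h : DefinesOn Ω U ρ)
    (hpsh : ∀ q ∈ frontier Ω ∩ U, ∀ ξ, 0 ≤ leviForm ρ q ξ ξ) (hp : p ∈ frontier Ω ∩ U)
    (htype : ¬ IsOfType Ω p 4) (h0 : leviFun ρ p = 0) : fderiv ℝ (leviFun ρ) p = 0 := by
  have hL : ContDiffAt ℝ 1 (tangentField ρ) p :=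
    contDiffAt_infty.1 (h.contDiffAt_tangentField hp.2) 1
  have hLd := hL.differentiableAt (by simp)
  have hg : ContDiffAt ℝ 2 (leviFun ρ) p := contDiffAt_infty.1 (h.contDiffAt_leviFun hp.2) 2
  have hρ2 := h.contDiffAt_two hp.2
  have hρ3 := h.contDiffAt_three hp.2
  have hnn : ∀ z ∈ frontier Ω ∩ U, 0 ≤ leviFun ρ z := fun z hz => hpsh z hz _
  have hQ0 : ∀ ζ, leviForm ρ p (tangentField ρ p) ζ = 0 :=
    leviForm_eq_zero_of_self hρ2 (hpsh p hp) h0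
  obtain ⟨hX, hY⟩ := fderiv_eq_zero_of_wordDeriv hg hLd
    (h.wordDeriv_leviFun_eq_zero hΩ hpsh hp htype h0 (w := [true, true]) rfl)
    (h.wordDeriv_leviFun_eq_zero hΩ hpsh hp htype h0 (w := [false, true]) rfl)
  set w := tangentField ρ p with hw
  set L' := fderiv ℝ (tangentField ρ) p with hL'
  have hLD : HasFDerivAt (tangentField ρ) L' p := hLd.hasFDerivAt
  -- the mixed terms are stationary in the complex tangential directions
  have hmix (N : CC2) : ContDiffAt ℝ ∞ (fun z => leviForm ρ z (tangentField ρ z) N) p :=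
    ContDiffAt.leviForm_apply (h.contDiffAt_fderiv_fderiv hp.2)
      (h.contDiffAt_tangentField hp.2) contDiffAt_const
  have hbound (N : CC2) : ∃ C, ∀ᶠ z in 𝓝 p, z ∈ frontier Ω →
      leviForm ρ z (tangentField ρ z) N ^ 2 ≤ C * leviFun ρ z := by
    have hcont : ContinuousAt (fun z => leviForm ρ z N N) p :=
      (ContDiffAt.leviForm_apply (h.contDiffAt_fderiv_fderiv hp.2)
        contDiffAt_const contDiffAt_const).continuousAt
    refine ⟨leviForm ρ p N N + 1, ?_⟩
    filter_upwards [hcont.eventually (gt_mem_nhds (lt_add_one _)), h.isOpen.mem_nhds hp.2]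
      with z hz hzU hzF
    have h1 := leviForm_sq_le (h.contDiffAt_two hzU) (hpsh z ⟨hzF, hzU⟩) (tangentField ρ z) N
    have h2 : 0 ≤ leviFun ρ z := hnn z ⟨hzF, hzU⟩
    rw [mul_comm] at h1
    exact h1.trans (mul_le_mul_of_nonneg_right hz.le h2)
  have hmixX (N : CC2) : fderiv ℝ (fun z => leviForm ρ z (tangentField ρ z) N) p w = 0 := by
    obtain ⟨C, hC⟩ := hbound N
    exact h.fderiv_eq_zero_of_sq_le hΩ hp hL (fderiv_tangentField ρ) hg
      ((hmix N).differentiableAt (by simp)) h0 hnn hX hC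
  have hmixY (N : CC2) :
      fderiv ℝ (fun z => leviForm ρ z (tangentField ρ z) N) p (I • w) = 0 := by
    obtain ⟨C, hC⟩ := hbound N
    exact h.fderiv_eq_zero_of_sq_le hΩ hp (hL.const_smul I) (fderiv_I_smul_tangentField ρ) hg
      ((hmix N).differentiableAt (by simp)) h0 hnn hY hC
  -- the `∂̄`-derivative of the tangential field is tangential
  have hv : delForm ρ p (L' w + I • L' (I • w)) = 0 := by
    have hD := hρ2.differentiableAt_fderiv.hasFDerivAt
    have e1 (u : CC2) : fderiv ℝ (fderiv ℝ ρ) p u w + fderiv ℝ ρ p (L' u) = 0 := by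
      have e := (hD.clm_apply hLD).unique
        ((hasFDerivAt_const (0 : ℝ) p).congr_of_eventuallyEq
          (Eventually.of_forall (fderiv_tangentField ρ)))
      have := congrArg (fun T : CC2 →L[ℝ] ℝ => T u) e
      simp [← hw] at this
      linarith
    have e2 (u : CC2) : fderiv ℝ (fderiv ℝ ρ) p u (I • w) + fderiv ℝ ρ p (I • L' u) = 0 := by
      have e := (hD.clm_apply (hLD.const_smul I)).unique
        ((hasFDerivAt_const (0 : ℝ) p).congr_of_eventuallyEq
          (Eventually.of_forall (fderiv_I_smul_tangentField ρ)))
      have := congrArg (fun T : CC2 →L[ℝ] ℝ => T u) e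
      simp [← hw] at this
      linarith
    have e3 : leviForm ρ p w w = 0 := h0
    have e4 := hρ2.snd_fderiv_symm w (I • w)
    have a1 := e1 w
    have a2 := e1 (I • w)
    have a3 := e2 w
    have a4 := e2 (I • w)
    rw [leviForm] at e3
    rw [delForm_eq_zero_iff, smul_add, I_smul_I_smul, map_add, map_add, map_neg]
    constructor <;> linarith
  obtain ⟨c, hc⟩ := exists_eq_smul_tangentField (h.fderiv_ne_zero p hp) hv
  -- The combination of derivatives of the field is a multiple of `w`, hence in the kernel of the
  -- Hessian by `hQ0`.
  have hcancel (N : CC2) : leviForm ρ p (L' w) N - leviForm ρ p (L' (I • w)) (I • N) = 0 := by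
    have : leviForm ρ p (L' w + I • L' (I • w)) N = 0 := by
      rw [hc, complex_smul_eq, leviForm_add_left, leviForm_smul_left, leviForm_smul_left,
        leviForm_I_left, hQ0, hQ0]
      simp
    rw [leviForm_add_left, leviForm_I_left] at this
    linarith
  ext N
  have f1 := hmixX N
  have f2 := hmixY (I • N)
  -- Subtracting `f2` from `f1`, the terms with `w, I • w, I • N` cancel by `f5` and those with
  -- derivatives of the field by `hcancel`; what remains is the third-order expression for the
  -- derivative of `leviFun ρ` along `N`.
  rw [hasFDerivAt_leviForm_apply hρ3 hLD (hasFDerivAt_const _ p)] at f1 f2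
  have f3 := hasFDerivAt_leviForm_apply hρ3 hLD hLD N
  change fderiv ℝ (leviFun ρ) p N = _ at f3
  rw [f3, ← hw, leviForm_symm hρ2 (L' N), hQ0, hρ3.third_fderiv_symm N w w,
    hρ3.third_fderiv_symm N (I • w) (I • w), hρ3.third_fderiv_symm' w N w,
    hρ3.third_fderiv_symm' (I • w) N (I • w)]
  simp only [← hw, zero_apply, hQ0, I_smul_I_smul, map_neg] at f1 f2 ⊢
  have f4 := hcancel N
  have f5 := hρ3.third_fderiv_symm (I • w) w (I • N)
  linarith

end WeaklyPseudoconvex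

/-! ### Lower bound for the complex Hessian near the boundary. -/

section LocalEstimate

variable {Ω U : Set CC2} {ρ : CC2 → ℝ} {p : CC2}

theorem abs_bilinear_I_le (T : CC2 →L[ℝ] CC2 →L[ℝ] ℝ) (ξ ζ : CC2) :
    |(T ξ ζ + T (I • ξ) (I • ζ)) / 4| ≤ ‖T‖ * ‖ξ‖ * ‖ζ‖ := by
  have h1 := T.le_opNorm₂ ξ ζ
  have h2 := T.le_opNorm₂ (I • ξ) (I • ζ)
  simp only [norm_smul, norm_I, one_mul, Real.norm_eq_abs] at h1 h2
  rw [abs_le] at *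
  have h3 : 0 ≤ ‖T‖ * ‖ξ‖ * ‖ζ‖ := by positivity
  constructor <;> linarith

theorem abs_leviForm_le (f : CC2 → ℝ) (z ξ ζ : CC2) :
    |leviForm f z ξ ζ| ≤ ‖fderiv ℝ (fderiv ℝ f) z‖ * ‖ξ‖ * ‖ζ‖ :=
  abs_bilinear_I_le _ ξ ζ

theorem abs_leviForm_sub_le (f : CC2 → ℝ) (z q ξ ξ' ζ : CC2) :
    |leviForm f z ξ ζ - leviForm f q ξ' ζ|
      ≤ ‖fderiv ℝ (fderiv ℝ f) z - fderiv ℝ (fderiv ℝ f) q‖ * ‖ξ‖ * ‖ζ‖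
        + ‖fderiv ℝ (fderiv ℝ f) q‖ * ‖ξ - ξ'‖ * ‖ζ‖ := by
  have h1 := abs_bilinear_I_le (fderiv ℝ (fderiv ℝ f) z - fderiv ℝ (fderiv ℝ f) q) ξ ζ
  have h2 := abs_bilinear_I_le (fderiv ℝ (fderiv ℝ f) q) (ξ - ξ') ζ
  refine le_trans (le_of_eq ?_) ((abs_add_le _ _).trans (add_le_add h1 h2))
  congr 1
  simp only [leviForm, sub_apply, smul_sub, map_sub]
  ring

/-- Splitting of vectors into a tangential and a transversal part, locally uniformly. -/
theorem DefinesOn.exists_splitting (h : DefinesOn Ω U ρ) (hp : p ∈ frontier Ω ∩ U) :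
    ∃ M : CC2, ∃ C > 0, ∀ᶠ z in 𝓝 p, ∀ ξ : CC2, ∃ c b : ℂ, ξ = c • tangentField ρ z + b • M ∧
      ‖b‖ ≤ 2 * ‖delForm ρ z ξ‖ ∧ ‖c‖ ≤ C * (‖ξ‖ + ‖delForm ρ z ξ‖) := by
  have hD := h.fderiv_ne_zero p hp
  obtain ⟨M, hM⟩ := exists_delForm_eq_one hD
  have hL : 0 < ‖tangentField ρ p‖ := norm_pos_iff.2 (tangentField_ne_zero hD)
  set l := ‖tangentField ρ p‖ / 2 with hl
  have hcM : ContinuousAt (fun z => ‖delForm ρ z M‖) p :=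
    (contDiffAt_delForm (h.contDiffAt_fderiv hp.2) M).continuousAt.norm
  have hcL : ContinuousAt (fun z => ‖tangentField ρ z‖) p :=
    (h.contDiffAt_tangentField hp.2).continuousAt.norm
  refine ⟨M, (1 + 2 * ‖M‖) / l, by positivity, ?_⟩
  filter_upwards [h.eventually_fderiv_ne_zero hp,
    hcM.eventually (lt_mem_nhds (show 1 / 2 < ‖delForm ρ p M‖ by rw [hM]; norm_num)),
    hcL.eventually (lt_mem_nhds (show l < ‖tangentField ρ p‖ by rw [hl]; linarith))]
    with z hDz hMz hLz ξ
  have hM0 : delForm ρ z M ≠ 0 := norm_pos_iff.1 (by linarith)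
  set b := delForm ρ z ξ / delForm ρ z M with hb
  obtain ⟨c, hc⟩ := exists_eq_smul_tangentField hDz (ξ := ξ + (-b) • M) (by
    rw [delForm_add, delForm_smul, hb]; field_simp; ring)
  have hξ : ξ = c • tangentField ρ z + b • M := by
    rw [← hc, neg_smul]; abel
  have hbn : ‖b‖ ≤ 2 * ‖delForm ρ z ξ‖ := by
    rw [hb, norm_div, div_le_iff₀ (by linarith)]
    nlinarith [norm_nonneg (delForm ρ z ξ)]
  refine ⟨c, b, hξ, hbn, ?_⟩
  have h1 : ‖c‖ * ‖tangentField ρ z‖ ≤ ‖ξ‖ + ‖b‖ * ‖M‖ := by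
    rw [← norm_smul, ← hc, ← norm_smul, neg_smul, ← sub_eq_add_neg]
    exact norm_sub_le _ _
  have hl0 : 0 < l := by positivity
  rw [div_mul_eq_mul_div, le_div_iff₀ hl0]
  have h2 : ‖c‖ * l ≤ ‖c‖ * ‖tangentField ρ z‖ :=
    mul_le_mul_of_nonneg_left hLz.le (norm_nonneg c)
  have h3 : ‖b‖ * ‖M‖ ≤ 2 * ‖delForm ρ z ξ‖ * ‖M‖ :=
    mul_le_mul_of_nonneg_right hbn (norm_nonneg M)
  nlinarith [norm_nonneg ξ, norm_nonneg M, norm_nonneg (delForm ρ z ξ),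
    mul_nonneg (norm_nonneg ξ) (norm_nonneg M)]

theorem leviForm_splitting (hf : ContDiffAt ℝ 2 ρ p) (c b : ℂ) (M : CC2) :
    leviForm ρ p (c • tangentField ρ p + b • M) (c • tangentField ρ p + b • M)
      = ‖c‖ ^ 2 * leviFun ρ p + 2 * leviForm ρ p (c • tangentField ρ p) (b • M)
        + ‖b‖ ^ 2 * leviForm ρ p M M := by
  rw [leviForm_add_left, leviForm_add_right, leviForm_add_right, leviForm_complex_smul hf,
    leviForm_complex_smul hf, leviForm_symm hf (b • M), leviFun]
  ring

/-- Near a strictly pseudoconvex boundary point only the transversal part can be negative. -/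
theorem DefinesOn.splitting_bound_of_pos (h : DefinesOn Ω U ρ) (hp : p ∈ frontier Ω ∩ U)
    (hpos : 0 < leviFun ρ p) (M : CC2) :
    ∃ C, ∀ᶠ z in 𝓝 p, ∀ c b : ℂ, -(C * ‖b‖ ^ 2) ≤
      leviForm ρ z (c • tangentField ρ z + b • M) (c • tangentField ρ z + b • M) := by
  have hcD : ContinuousAt (fun z => ‖fderiv ℝ (fderiv ℝ ρ) z‖) p :=
    (continuous_norm (E := CC2 →L[ℝ] CC2 →L[ℝ] ℝ)).continuousAt.comp
      (h.contDiffAt_fderiv_fderiv hp.2).continuousAt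
  have hcL : ContinuousAt (fun z => ‖tangentField ρ z‖) p :=
    (h.contDiffAt_tangentField hp.2).continuousAt.norm
  set l := leviFun ρ p / 2 with hl
  set A := ‖fderiv ℝ (fderiv ℝ ρ) p‖ + 1 with hA
  set B := ‖tangentField ρ p‖ + 1 with hB
  have hl0 : 0 < l := by positivity
  refine ⟨(A * B * ‖M‖) ^ 2 / l + A * ‖M‖ * ‖M‖, ?_⟩
  filter_upwards [h.isOpen.mem_nhds hp.2,
    (h.contDiffAt_leviFun hp.2).continuousAt.eventually
      (lt_mem_nhds (show l < leviFun ρ p by rw [hl]; linarith)),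
    hcD.eventually (gt_mem_nhds (lt_add_one _)), hcL.eventually (gt_mem_nhds (lt_add_one _))]
    with z hzU hz hAz hBz c b
  rw [leviForm_splitting (h.contDiffAt_two hzU)]
  have h1 := abs_leviForm_le ρ z (c • tangentField ρ z) (b • M)
  have h2 := abs_leviForm_le ρ z M M
  rw [norm_smul, norm_smul] at h1
  have h3 : ‖fderiv ℝ (fderiv ℝ ρ) z‖ * (‖c‖ * ‖tangentField ρ z‖) * (‖b‖ * ‖M‖)
      ≤ A * B * ‖M‖ * ‖c‖ * ‖b‖ := by
    calc _ ≤ A * (‖c‖ * B) * (‖b‖ * ‖M‖) := by gcongr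
      _ = _ := by ring
  have h4 : ‖fderiv ℝ (fderiv ℝ ρ) z‖ * ‖M‖ * ‖M‖ ≤ A * ‖M‖ * ‖M‖ := by gcongr
  have h5 := neg_abs_le (leviForm ρ z (c • tangentField ρ z) (b • M))
  have h6 := neg_abs_le (leviForm ρ z M M)
  set K := A * B * ‖M‖
  have h7 : ‖c‖ ^ 2 * l ≤ ‖c‖ ^ 2 * leviFun ρ z := by gcongr
  have h8 : ‖b‖ ^ 2 * -(A * ‖M‖ * ‖M‖) ≤ ‖b‖ ^ 2 * leviForm ρ z M M := by
    gcongr; linarith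
  -- The positive tangential part absorbs the mixed term, at the price of `K² / l` on the
  -- transversal part.
  have h9 : 0 ≤ ‖c‖ ^ 2 * l - 2 * (K * ‖c‖ * ‖b‖) + K ^ 2 / l * ‖b‖ ^ 2 := by
    have : ‖c‖ ^ 2 * l - 2 * (K * ‖c‖ * ‖b‖) + K ^ 2 / l * ‖b‖ ^ 2
        = (l * ‖c‖ - K * ‖b‖) ^ 2 / l := by field_simp; ring
    rw [this]; positivity
  linarith

/-- Near a boundary point at which the Levi function is stationary, the tangential part is bounded
from below by an arbitrarily small multiple of the defining function. -/
theorem DefinesOn.splitting_bound_of_stationary (hΩ : IsOpen Ω) (h : DefinesOn Ω U ρ)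
    (hpsh : ∀ q ∈ frontier Ω ∩ U, ∀ ξ, 0 ≤ leviForm ρ q ξ ξ) (hp : p ∈ frontier Ω ∩ U)
    (hstat : fderiv ℝ (leviFun ρ) p = 0) (M : CC2) {ε : ℝ} (hε : 0 < ε) :
    ∃ C, ∀ᶠ z in 𝓝 p, ∀ c b : ℂ, -(ε * |ρ z| * ‖c‖ ^ 2) - C * ‖b‖ ^ 2 ≤
      leviForm ρ z (c • tangentField ρ z + b • M) (c • tangentField ρ z + b • M) := by
  obtain ⟨C₁, hC₁, hnear⟩ := h.exists_frontier_near hΩ hp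
  -- The factor `2` leaves room for two errors `e * d` on `‖c‖²`: one from the Levi function, one
  -- from the mixed term; `C₁` converts distance into `|ρ z|`.
  set e := ε / (2 * C₁) with he
  have he0 : 0 < e := by positivity
  -- Strict differentiability is needed: the comparison is between two moving points `z` and `q`,
  -- not with `p`.
  have hstrict : HasStrictFDerivAt (leviFun ρ) (0 : CC2 →L[ℝ] ℝ) p := by
    rw [← hstat]
    exact (h.contDiffAt_leviFun hp.2).hasStrictFDerivAt (by simp)
  have hlam : ∀ᶠ x in 𝓝 (p, p), ‖leviFun ρ x.1 - leviFun ρ x.2‖ ≤ e * ‖x.1 - x.2‖ := by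
    simpa using hstrict.isLittleO.def he0
  rw [nhds_prod_eq] at hlam
  obtain ⟨s₁, hs₁, hlam'⟩ := (Filter.eventually_prod_self_iff (r := fun x y =>
    ‖leviFun ρ x - leviFun ρ y‖ ≤ e * ‖x - y‖)).1 hlam
  obtain ⟨K₁, s₂, hs₂, hK₁⟩ := ContDiffAt.exists_lipschitzOnWith
    (contDiffAt_infty.1 (h.contDiffAt_fderiv_fderiv hp.2) 1)
  obtain ⟨K₂, s₃, hs₃, hK₂⟩ := ContDiffAt.exists_lipschitzOnWith
    (contDiffAt_infty.1 (h.contDiffAt_tangentField hp.2) 1)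
  have hcD : ContinuousAt (fun z => ‖fderiv ℝ (fderiv ℝ ρ) z‖) p :=
    (continuous_norm (E := CC2 →L[ℝ] CC2 →L[ℝ] ℝ)).continuousAt.comp
      (h.contDiffAt_fderiv_fderiv hp.2).continuousAt
  have hcL : ContinuousAt (fun z => ‖tangentField ρ z‖) p :=
    (h.contDiffAt_tangentField hp.2).continuousAt.norm
  set A := ‖fderiv ℝ (fderiv ℝ ρ) p‖ + 1 with hA
  set B := ‖tangentField ρ p‖ + 1 with hB
  have hev : ∀ᶠ z in 𝓝 p, z ∈ U ∧ z ∈ s₁ ∧ z ∈ s₂ ∧ z ∈ s₃ ∧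
      ‖fderiv ℝ (fderiv ℝ ρ) z‖ < A ∧ ‖tangentField ρ z‖ < B := by
    filter_upwards [h.isOpen.mem_nhds hp.2, hs₁, hs₂, hs₃,
      hcD.eventually (gt_mem_nhds (lt_add_one _)), hcL.eventually (gt_mem_nhds (lt_add_one _))]
      with z a1 a2 a3 a4 a5 a6 using ⟨a1, a2, a3, a4, a5, a6⟩
  obtain ⟨δ, hδ, hball⟩ := Metric.eventually_nhds_iff_ball.1 hev
  have hρ0 : Tendsto (fun z => C₁ * |ρ z|) (𝓝 p) (𝓝 0) := by
    have : ContinuousAt (fun z => C₁ * |ρ z|) p :=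
      continuousAt_const.mul (h.contDiffAt hp.2).continuousAt.abs
    simpa [ContinuousAt, h.eq_zero hΩ hp] using this
  set K := (K₁ * B + A * K₂) * ‖M‖ with hK
  have hK0 : 0 ≤ K := by positivity
  have hB0 : 0 < B := by positivity
  set K' := K₁ * ‖M‖ * ‖M‖ with hK'
  refine ⟨(K ^ 2 / e + K') * 1, ?_⟩
  filter_upwards [Metric.ball_mem_nhds p (half_pos hδ), hnear,
    hρ0.eventually (gt_mem_nhds (half_pos hδ)), hρ0.eventually (gt_mem_nhds one_pos)]
    with z hz ⟨q, hqF, hzq⟩ hsmall hone c b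
  have hzb : z ∈ Metric.ball p δ := Metric.ball_subset_ball (by linarith) hz
  have hqb : q ∈ Metric.ball p δ := by
    rw [Metric.mem_ball] at hz ⊢
    have := dist_triangle q z p
    rw [dist_comm q z, dist_eq_norm z q] at this
    linarith
  obtain ⟨zU, z1, z2, z3, zA, zB⟩ := hball z hzb
  obtain ⟨qU, q1, q2, q3, qA, qB⟩ := hball q hqb
  set d := ‖z - q‖ with hd
  have hd0 : 0 ≤ d := norm_nonneg _
  have hd1 : d ≤ 1 := by linarith
  have b1 : |leviFun ρ z - leviFun ρ q| ≤ e * d := hlam' z z1 q q1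
  have b2 : ‖fderiv ℝ (fderiv ℝ ρ) z - fderiv ℝ (fderiv ℝ ρ) q‖ ≤ K₁ * d :=
    hK₁.norm_sub_le z2 q2
  have b3 : ‖tangentField ρ z - tangentField ρ q‖ ≤ K₂ * d := hK₂.norm_sub_le z3 q3
  -- The vector at `q` has the same coefficients `c`, `b`, but uses the tangential field at `q`, so
  -- that `leviFun ρ` is compared with itself.
  have hpos := hpsh q ⟨hqF, qU⟩ (c • tangentField ρ q + b • M)
  rw [leviForm_splitting (h.contDiffAt_two qU)] at hpos
  rw [leviForm_splitting (h.contDiffAt_two zU)]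
  have m1 := abs_leviForm_sub_le ρ z q (c • tangentField ρ z) (c • tangentField ρ q) (b • M)
  rw [← smul_sub, norm_smul, norm_smul, norm_smul] at m1
  have m2 : ‖fderiv ℝ (fderiv ℝ ρ) z - fderiv ℝ (fderiv ℝ ρ) q‖ * (‖c‖ * ‖tangentField ρ z‖)
        * (‖b‖ * ‖M‖)
      + ‖fderiv ℝ (fderiv ℝ ρ) q‖ * (‖c‖ * ‖tangentField ρ z - tangentField ρ q‖) * (‖b‖ * ‖M‖)
      ≤ K * ‖c‖ * ‖b‖ * d := by
    calc _ ≤ K₁ * d * (‖c‖ * B) * (‖b‖ * ‖M‖) + A * (‖c‖ * (K₂ * d)) * (‖b‖ * ‖M‖) := by gcongr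
      _ = _ := by rw [hK]; ring
  have m3 := abs_leviForm_sub_le ρ z q M M M
  have m4 : ‖fderiv ℝ (fderiv ℝ ρ) z - fderiv ℝ (fderiv ℝ ρ) q‖ * ‖M‖ * ‖M‖ ≤ K' * d := by
    calc _ ≤ K₁ * d * ‖M‖ * ‖M‖ := by gcongr
      _ = _ := by rw [hK']; ring
  rw [sub_self, norm_zero, mul_zero, zero_mul, add_zero] at m3
  have n1 := (abs_le.1 b1).1
  have n2 := (abs_le.1 (m1.trans m2)).1
  have n3 := (abs_le.1 (m3.trans m4)).1
  have o1 : ‖c‖ ^ 2 * -(e * d) ≤ ‖c‖ ^ 2 * (leviFun ρ z - leviFun ρ q) := by gcongr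
  have o3 : ‖b‖ ^ 2 * -(K' * d) ≤ ‖b‖ ^ 2 * (leviForm ρ z M M - leviForm ρ q M M) := by gcongr
  have o2 : 0 ≤ d * (e * ‖c‖ ^ 2 - 2 * (K * ‖c‖ * ‖b‖) + K ^ 2 / e * ‖b‖ ^ 2) := by
    have : e * ‖c‖ ^ 2 - 2 * (K * ‖c‖ * ‖b‖) + K ^ 2 / e * ‖b‖ ^ 2
        = (e * ‖c‖ - K * ‖b‖) ^ 2 / e := by field_simp; ring
    rw [this]; positivity
  have o4 : (K ^ 2 / e + K') * d * ‖b‖ ^ 2 ≤ (K ^ 2 / e + K') * 1 * ‖b‖ ^ 2 := by gcongr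
  have o5 : 2 * e * d * ‖c‖ ^ 2 ≤ ε * |ρ z| * ‖c‖ ^ 2 := by
    have : 2 * e * d ≤ ε * |ρ z| := by
      calc 2 * e * d ≤ 2 * e * (C₁ * |ρ z|) := by gcongr
        _ = ε * |ρ z| := by rw [he]; field_simp
    gcongr
  linarith

/-- The local lower bound of the complex Hessian. -/
theorem DefinesOn.leviForm_bound (hΩ : IsOpen Ω) (h : DefinesOn Ω U ρ)
    (hpsh : ∀ q ∈ frontier Ω ∩ U, ∀ ξ, 0 ≤ leviForm ρ q ξ ξ) (hp : p ∈ frontier Ω ∩ U)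
    (htype : ¬ IsOfType Ω p 4) {ε : ℝ} (hε : 0 < ε) :
    ∃ C, ∀ᶠ z in 𝓝 p, ∀ ξ : CC2, -(ε * |ρ z| * ‖ξ‖ ^ 2) - C * ‖delForm ρ z ξ‖ ^ 2 ≤
      leviForm ρ z ξ ξ := by
  obtain ⟨M, C₀, hC₀, hsplit⟩ := h.exists_splitting hp
  set e := ε / (2 * C₀ ^ 2) with he
  have he0 : 0 < e := by positivity
  obtain ⟨C, hC⟩ : ∃ C, ∀ᶠ z in 𝓝 p, ∀ c b : ℂ, -(e * |ρ z| * ‖c‖ ^ 2) - C * ‖b‖ ^ 2 ≤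
      leviForm ρ z (c • tangentField ρ z + b • M) (c • tangentField ρ z + b • M) := by
    rcases (show 0 ≤ leviFun ρ p from hpsh p hp _).eq_or_lt with h0 | hpos
    · exact h.splitting_bound_of_stationary hΩ hpsh hp
        (h.fderiv_leviFun_eq_zero hΩ hpsh hp htype h0.symm) M he0
    · obtain ⟨C, hC⟩ := h.splitting_bound_of_pos hp hpos M
      refine ⟨C, hC.mono fun z hz c b => le_trans ?_ (hz c b)⟩
      have : 0 ≤ e * |ρ z| * ‖c‖ ^ 2 := by positivity
      linarith
  -- The `4` comes from `‖b‖ ≤ 2 * ‖delForm ρ z ξ‖`; the `ε` pays for the transversal part of the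
  -- bound on `‖c‖²`, using `|ρ z| < 1`.
  refine ⟨ε + |C| * 4, ?_⟩
  have hρ1 : ∀ᶠ z in 𝓝 p, |ρ z| < 1 := by
    refine (h.contDiffAt hp.2).continuousAt.abs.eventually (gt_mem_nhds ?_)
    simp [h.eq_zero hΩ hp]
  filter_upwards [hsplit, hC, hρ1] with z hz hCz hρz ξ
  obtain ⟨c, b, hξ, hb, hc⟩ := hz ξ
  have key := hCz c b
  rw [← hξ] at key
  refine le_trans ?_ key
  set α := ‖delForm ρ z ξ‖
  have hα : 0 ≤ α := norm_nonneg _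
  have h1 : ‖c‖ ^ 2 ≤ 2 * C₀ ^ 2 * (‖ξ‖ ^ 2 + α ^ 2) := by
    calc ‖c‖ ^ 2 ≤ (C₀ * (‖ξ‖ + α)) ^ 2 := by gcongr
      _ ≤ _ := by nlinarith [sq_nonneg (C₀ * (‖ξ‖ - α))]
  have h2 : e * |ρ z| * ‖c‖ ^ 2 ≤ ε * |ρ z| * (‖ξ‖ ^ 2 + α ^ 2) := by
    calc e * |ρ z| * ‖c‖ ^ 2 ≤ e * |ρ z| * (2 * C₀ ^ 2 * (‖ξ‖ ^ 2 + α ^ 2)) := by gcongr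
      _ = _ := by rw [he]; field_simp
  have h3 : ε * |ρ z| * α ^ 2 ≤ ε * 1 * α ^ 2 := by gcongr
  have h4 : C * ‖b‖ ^ 2 ≤ |C| * (2 * α) ^ 2 := by
    calc C * ‖b‖ ^ 2 ≤ |C| * ‖b‖ ^ 2 := by gcongr; exact le_abs_self C
      _ ≤ _ := by gcongr
  linarith

/-- The lower bound of the complex Hessian, uniformly near the boundary. -/
theorem DefinesOn.leviForm_bound_nhdsSet (hΩ : IsOpen Ω) (hb : Bornology.IsBounded Ω)
    (h : DefinesOn Ω U ρ) (hU : frontier Ω ⊆ U)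
    (hpsh : ∀ q ∈ frontier Ω, ∀ ξ, 0 ≤ leviForm ρ q ξ ξ)
    (htype : ∀ p ∈ frontier Ω, ¬ IsOfType Ω p 4) {ε : ℝ} (hε : 0 < ε) :
    ∃ C, ∀ᶠ z in 𝓝ˢ (frontier Ω), ∀ ξ : CC2,
      -(ε * |ρ z| * ‖ξ‖ ^ 2) - C * ‖delForm ρ z ξ‖ ^ 2 ≤ leviForm ρ z ξ ξ := by
  have hcomp : IsCompact (frontier Ω) :=
    Metric.isCompact_of_isClosed_isBounded isClosed_frontier
      (hb.closure.subset frontier_subset_closure)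
  choose! C hC using fun p (hp : p ∈ frontier Ω) =>
    h.leviForm_bound hΩ (fun q hq => hpsh q hq.1) ⟨hp, hU hp⟩ (htype p hp) hε
  obtain ⟨t, htF, ht⟩ := hcomp.elim_nhds_subcover
    (fun p => {z | ∀ᶠ w in 𝓝 z, ∀ ξ : CC2,
      -(ε * |ρ w| * ‖ξ‖ ^ 2) - C p * ‖delForm ρ w ξ‖ ^ 2 ≤ leviForm ρ w ξ ξ})
    (fun p hp => eventually_eventually_nhds.2 (hC p hp))
  refine ⟨∑ p ∈ t, |C p|, ?_⟩
  rw [eventually_nhdsSet_iff_forall]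
  intro q hq
  obtain ⟨p, hpt, hqp⟩ := mem_iUnion₂.1 (ht hq)
  have hle : C p ≤ ∑ p ∈ t, |C p| :=
    (le_abs_self _).trans (Finset.single_le_sum (f := fun p => |C p|)
      (fun _ _ => abs_nonneg _) hpt)
  filter_upwards [hqp] with w hw ξ
  refine le_trans ?_ (hw ξ)
  gcongr

end LocalEstimate

/-! ### Complex Hessians of combinations, exponentials, logarithms and `|z|²`. -/

section Composition

variable {f g : CC2 → ℝ} {z : CC2}

theorem leviForm_neg (ξ ζ : CC2) :
    leviForm (fun w => -f w) z ξ ζ = -leviForm f z ξ ζ := by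
  have h : fderiv ℝ (fun w => -f w) = fun w => -fderiv ℝ f w := by
    ext1 w; exact fderiv_fun_neg
  rw [leviForm, h, fderiv_fun_neg, leviForm]
  simp only [neg_apply]
  ring

theorem leviForm_comb (hf : ContDiffAt ℝ 2 f z) (hg : ContDiffAt ℝ 2 g z) (a b : ℝ)
    (ξ ζ : CC2) : leviForm (fun w => a * f w + b * g w) z ξ ζ
      = a * leviForm f z ξ ζ + b * leviForm g z ξ ζ := by
  have h : fderiv ℝ (fun w => a * f w + b * g w) =ᶠ[𝓝 z]
      fun w => a • fderiv ℝ f w + b • fderiv ℝ g w := by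
    filter_upwards [hf.eventually_differentiableAt le_rfl,
      hg.eventually_differentiableAt le_rfl] with w h1 h2
    exact ((h1.hasFDerivAt.const_mul a).add (h2.hasFDerivAt.const_mul b)).fderiv
  have h2 := ((hf.differentiableAt_fderiv.hasFDerivAt.const_smul a).add
    (hg.differentiableAt_fderiv.hasFDerivAt.const_smul b)).fderiv
  rw [leviForm, h.fderiv_eq, leviForm, leviForm]
  erw [h2]
  simp
  ring

theorem delForm_comb (hf : DifferentiableAt ℝ f z) (hg : DifferentiableAt ℝ g z) (a b : ℝ)
    (ξ : CC2) : delForm (fun w => a * f w + b * g w) z ξ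
      = a * delForm f z ξ + b * delForm g z ξ := by
  have h := ((hf.hasFDerivAt.const_mul a).add (hg.hasFDerivAt.const_mul b)).fderiv
  rw [delForm]
  erw [h]
  simp [delForm]
  ring

theorem leviForm_exp (hg : ContDiffAt ℝ 2 g z) (ξ : CC2) :
    leviForm (fun w => Real.exp (g w)) z ξ ξ
      = Real.exp (g z) * (leviForm g z ξ ξ + ‖delForm g z ξ‖ ^ 2) := by
  have h : fderiv ℝ (fun w => Real.exp (g w)) =ᶠ[𝓝 z]
      fun w => Real.exp (g w) • fderiv ℝ g w := by
    filter_upwards [hg.eventually_differentiableAt le_rfl] with w h1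
    exact h1.hasFDerivAt.exp.fderiv
  have h2 := ((hg.differentiableAt (by simp)).hasFDerivAt.exp.smul
    hg.differentiableAt_fderiv.hasFDerivAt).fderiv
  rw [leviForm, h.fderiv_eq, norm_sq_delForm, leviForm]
  erw [h2]
  simp
  ring

theorem delForm_log (hf : DifferentiableAt ℝ f z) (h0 : f z ≠ 0) (ξ : CC2) :
    delForm (fun w => Real.log (f w)) z ξ = delForm f z ξ / f z := by
  rw [delForm, (hf.hasFDerivAt.log h0).fderiv, delForm]
  simp
  ring

theorem leviForm_log (hf : ContDiffAt ℝ 2 f z) (h0 : f z ≠ 0) (ξ : CC2) :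
    leviForm (fun w => Real.log (f w)) z ξ ξ
      = leviForm f z ξ ξ / f z - ‖delForm f z ξ‖ ^ 2 / f z ^ 2 := by
  have h : fderiv ℝ (fun w => Real.log (f w)) =ᶠ[𝓝 z]
      fun w => (f w)⁻¹ • fderiv ℝ f w := by
    filter_upwards [hf.eventually_differentiableAt le_rfl,
      hf.continuousAt.eventually_ne h0] with w h1 h2
    exact (h1.hasFDerivAt.log h2).fderiv
  have hinv : HasFDerivAt (fun w => (f w)⁻¹) (-(f z ^ 2)⁻¹ • fderiv ℝ f z) z :=
    (hasDerivAt_inv h0).comp_hasFDerivAt z (hf.differentiableAt (by simp)).hasFDerivAt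
  have h2 := (hinv.smul hf.differentiableAt_fderiv.hasFDerivAt).fderiv
  rw [leviForm, h.fderiv_eq, norm_sq_delForm, leviForm]
  erw [h2]
  simp
  field_simp
  ring

theorem hasFDerivAt_norm_sq (z : CC2) :
    HasFDerivAt (fun w : CC2 => ‖w‖ ^ 2) ((2 : ℝ) • innerSL ℝ z) z := by
  refine (hasFDerivAt_id z).norm_sq.congr_fderiv ?_
  ext; simp

theorem delForm_norm_sq (z ξ : CC2) :
    ‖delForm (fun w => ‖w‖ ^ 2) z ξ‖ ≤ ‖z‖ * ‖ξ‖ := by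
  have h : delForm (fun w => ‖w‖ ^ 2) z ξ = inner ℂ z ξ := by
    rw [delForm, (hasFDerivAt_norm_sq z).fderiv]
    apply Complex.ext <;> simp [PiLp.inner_apply, Fin.sum_univ_two]
    all_goals ring
  rw [h]
  exact norm_inner_le_norm z ξ

theorem leviForm_norm_sq (z ξ : CC2) :
    leviForm (fun w => ‖w‖ ^ 2) z ξ ξ = ‖ξ‖ ^ 2 := by
  have h : fderiv ℝ (fun w : CC2 => ‖w‖ ^ 2) = fun w => ((2 : ℝ) • innerSL ℝ) w := by
    ext1 w; exact (hasFDerivAt_norm_sq w).fderiv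
  have h2 : fderiv ℝ (fun w : CC2 => ((2 : ℝ) • innerSL ℝ (E := CC2)) w) z
      = (2 : ℝ) • innerSL ℝ := ContinuousLinearMap.fderiv _
  rw [leviForm, h]
  erw [h2]
  change (2 * inner ℝ ξ ξ + 2 * inner ℝ (I • ξ) (I • ξ)) / 4 = ‖ξ‖ ^ 2
  rw [real_inner_self_eq_norm_sq, real_inner_self_eq_norm_sq, norm_smul, norm_I]
  ring

theorem contDiff_norm_sq' {n : ℕ∞ω} : ContDiff ℝ n fun w : CC2 => ‖w‖ ^ 2 :=
  contDiff_norm_sq ℝ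

end Composition

/-! ### Powers of `|ρ| e^{θ|z|²}` and the two exponents. -/

section Exponents

variable {Ω U : Set CC2} {ρ : CC2 → ℝ} {z : CC2}

/-- The unwanted terms are of order `δ²` in `y²` after completing the square in `x`, so a small `δ`
lets the linear term win. Here `x` stands for `|∂ρ(ξ)|/|ρ|`, `y` for `‖ξ‖`, `κ` for the gap between
the exponent and `1`; `3/4` is what is left of `δ` after a Hessian error of `δ/4`. -/
theorem exists_small_coeff {κ s : ℝ} (R : ℝ) (hκ : 0 < κ) (hs : 0 < s) :
    ∃ δ > 0, ∀ x y : ℝ, 0 < y → 0 < κ / 2 * x ^ 2 - 2 * s * δ * R * x * y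
      - s * δ ^ 2 * R ^ 2 * y ^ 2 + 3 / 4 * δ * y ^ 2 := by
  set A := s * R ^ 2 + 2 * s ^ 2 * R ^ 2 / κ with hA
  have hA0 : 0 ≤ A := by positivity
  set δ := 1 / (4 * A + 1) with hδ
  have hδ0 : 0 < δ := by positivity
  have hδA : δ * A ≤ 1 / 4 := by
    rw [hδ, div_mul_eq_mul_div, div_le_iff₀ (by positivity)]; linarith
  refine ⟨δ, hδ0, fun x y hy => ?_⟩
  have h1 : 0 ≤ κ / 2 * x ^ 2 - 2 * s * δ * R * x * y + 2 * s ^ 2 * δ ^ 2 * R ^ 2 / κ * y ^ 2 := by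
    have : κ / 2 * x ^ 2 - 2 * s * δ * R * x * y + 2 * s ^ 2 * δ ^ 2 * R ^ 2 / κ * y ^ 2
        = (κ * x - 2 * s * δ * R * y) ^ 2 / (2 * κ) := by field_simp; ring
    rw [this]; positivity
  have h2 : δ * A * (δ * y ^ 2) ≤ 1 / 4 * (δ * y ^ 2) := by gcongr
  have h3 : δ * A * (δ * y ^ 2)
      = s * δ ^ 2 * R ^ 2 * y ^ 2 + 2 * s ^ 2 * δ ^ 2 * R ^ 2 / κ * y ^ 2 := by rw [hA]; ring
  have h4 : 0 < δ * y ^ 2 := by positivity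
  linarith

/-- The estimates near the boundary, in the form used for both indices. -/
theorem DefinesOn.exists_nbhd (hΩ : IsOpen Ω) (hb : Bornology.IsBounded Ω)
    (h : DefinesOn Ω U ρ) (hU : frontier Ω ⊆ U)
    (hpsh : ∀ q ∈ frontier Ω, ∀ ξ, 0 ≤ leviForm ρ q ξ ξ)
    (htype : ∀ p ∈ frontier Ω, ¬ IsOfType Ω p 4) {κ s : ℝ} (hκ : 0 < κ) (hs : 0 < s) :
    ∃ δ R : ℝ, 0 < δ ∧ 0 ≤ R ∧ (∀ x y : ℝ, 0 < y → 0 < κ / 2 * x ^ 2 - 2 * s * δ * R * x * y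
      - s * δ ^ 2 * R ^ 2 * y ^ 2 + 3 / 4 * δ * y ^ 2) ∧
    ∃ V, IsOpen V ∧ frontier Ω ⊆ V ∧ V ⊆ U ∧ ∀ z ∈ V, fderiv ℝ ρ z ≠ 0 ∧ ‖z‖ ≤ R ∧
      (ρ z ≠ 0 → ∀ ξ : CC2, -(δ / 4 * ‖ξ‖ ^ 2) - κ / 2 * (‖delForm ρ z ξ‖ / |ρ z|) ^ 2 ≤
        leviForm ρ z ξ ξ / |ρ z|) := by
  obtain ⟨R, hR0, hR⟩ : ∃ R > 0, frontier Ω ⊆ Metric.ball 0 R :=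
    (hb.closure.subset frontier_subset_closure).subset_ball_lt 0 0
  obtain ⟨δ, hδ, hδR⟩ := exists_small_coeff R hκ hs
  refine ⟨δ, R, hδ, hR0.le, hδR, ?_⟩
  obtain ⟨C, hC⟩ := h.leviForm_bound_nhdsSet hΩ hb hU hpsh htype
    (show 0 < δ / 4 by positivity)
  -- However large `C` is, closeness to the boundary makes `C * |ρ z|` small, so that the `C` term
  -- costs only half of the gap `κ`.
  have hsmall : ∀ᶠ z in 𝓝ˢ (frontier Ω), C * |ρ z| < κ / 2 := by
    rw [eventually_nhdsSet_iff_forall]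
    intro p hp
    have hc : ContinuousAt (fun z => C * |ρ z|) p :=
      continuousAt_const.mul (h.contDiffAt (hU hp)).continuousAt.abs
    refine hc.eventually (gt_mem_nhds ?_)
    simp [h.eq_zero hΩ ⟨hp, hU hp⟩, hκ]
  have hD : ∀ᶠ z in 𝓝ˢ (frontier Ω), fderiv ℝ ρ z ≠ 0 :=
    eventually_nhdsSet_iff_forall.2 fun p hp => h.eventually_fderiv_ne_zero ⟨hp, hU hp⟩
  have hall : ∀ᶠ z in 𝓝ˢ (frontier Ω), z ∈ U ∧ fderiv ℝ ρ z ≠ 0 ∧ ‖z‖ ≤ R ∧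
      (ρ z ≠ 0 → ∀ ξ : CC2, -(δ / 4 * ‖ξ‖ ^ 2) - κ / 2 * (‖delForm ρ z ξ‖ / |ρ z|) ^ 2 ≤
        leviForm ρ z ξ ξ / |ρ z|) := by
    filter_upwards [hC, hsmall, hD, h.isOpen.mem_nhdsSet.2 hU,
      Metric.isOpen_ball.mem_nhdsSet.2 hR] with z h1 h2 h3 h4 h5
    refine ⟨h4, h3, (mem_ball_zero_iff.1 h5).le, fun h0 ξ => ?_⟩
    have hpos : 0 < |ρ z| := abs_pos.2 h0
    rw [le_div_iff₀ hpos]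
    refine le_trans ?_ (h1 ξ)
    have e1 : κ / 2 * (‖delForm ρ z ξ‖ / |ρ z|) ^ 2 * |ρ z|
        = κ / 2 * (‖delForm ρ z ξ‖ ^ 2 / |ρ z|) := by field_simp
    have e2 : C * ‖delForm ρ z ξ‖ ^ 2 = C * |ρ z| * (‖delForm ρ z ξ‖ ^ 2 / |ρ z|) := by
      field_simp
    have e3 : C * |ρ z| * (‖delForm ρ z ξ‖ ^ 2 / |ρ z|)
        ≤ κ / 2 * (‖delForm ρ z ξ‖ ^ 2 / |ρ z|) := by gcongr
    rw [sub_mul, e1, e2]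
    linarith
  obtain ⟨V, hVo, hFV, hV⟩ := eventually_nhdsSet_iff_exists.1 hall
  exact ⟨V, hVo, hFV, fun z hz => (hV z hz).1, fun z hz => (hV z hz).2⟩

theorem DefinesOn.mono (h : DefinesOn Ω U ρ) {V : Set CC2} (hV : IsOpen V) (hVU : V ⊆ U) :
    DefinesOn Ω V ρ where
  isOpen := hV
  smooth := h.smooth.mono hVU
  neg_iff := fun z hz => h.neg_iff z (hVU hz)
  fderiv_ne_zero := fun z hz => h.fderiv_ne_zero z ⟨hz.1, hVU hz.2⟩

theorem DefinesOn.mul_exp (hΩ : IsOpen Ω) (h : DefinesOn Ω U ρ) (θ : ℝ) :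
    DefinesOn Ω U fun z => ρ z * Real.exp (θ * ‖z‖ ^ 2) where
  isOpen := h.isOpen
  smooth := h.smooth.mul (Real.contDiff_exp.comp
    (contDiff_const.mul contDiff_norm_sq')).contDiffOn
  neg_iff := fun z hz => by
    rw [← h.neg_iff z hz, mul_neg_iff]
    simp [Real.exp_pos, (Real.exp_pos _).not_gt]
  fderiv_ne_zero := fun z hz => by
    have h1 : DifferentiableAt ℝ (fun z : CC2 => Real.exp (θ * ‖z‖ ^ 2)) z :=
      ((Real.contDiff_exp.comp (contDiff_const.mul (contDiff_norm_sq' (n := 1)))).differentiable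
        (by simp)) z
    rw [((h.differentiableAt hz.2).hasFDerivAt.fun_mul h1.hasFDerivAt).fderiv, h.eq_zero hΩ hz,
      zero_smul, zero_add]
    exact smul_ne_zero (Real.exp_pos _).ne' (h.fderiv_ne_zero z hz)

/-- The logarithm of the power `s` of `|ρ| e ^ (θ |z|²)`. -/
noncomputable def logPower (ρ : CC2 → ℝ) (s θ : ℝ) (z : CC2) : ℝ :=
  s * Real.log (ρ z) + s * θ * ‖z‖ ^ 2

theorem contDiffAt_logPower (hρ : ContDiffAt ℝ 2 ρ z) (h0 : ρ z ≠ 0) (s θ : ℝ) :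
    ContDiffAt ℝ 2 (logPower ρ s θ) z :=
  (contDiffAt_const.mul (hρ.log h0)).add (contDiffAt_const.mul contDiff_norm_sq'.contDiffAt)

/-- Working with the logarithm turns the exponential factor into an additive `θ ‖ξ‖²` and isolates
the gradient terms `-x² + s|…|²`, whose balance depends on the exponent `s`. -/
theorem leviForm_exp_logPower (hρ : ContDiffAt ℝ 2 ρ z) (h0 : ρ z ≠ 0) (s θ : ℝ) (ξ : CC2) :
    leviForm (fun w => Real.exp (logPower ρ s θ w)) z ξ ξ
      = Real.exp (logPower ρ s θ z) * (s * (leviForm ρ z ξ ξ / ρ z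
          - (‖delForm ρ z ξ‖ / |ρ z|) ^ 2 + θ * ‖ξ‖ ^ 2
          + s * ‖delForm ρ z ξ / ρ z + θ * delForm (fun w => ‖w‖ ^ 2) z ξ‖ ^ 2)) := by
  rw [leviForm_exp (contDiffAt_logPower hρ h0 s θ)]
  have h1 : leviForm (logPower ρ s θ) z ξ ξ = _ :=
    leviForm_comb (hρ.log h0) contDiff_norm_sq'.contDiffAt s (s * θ) ξ ξ
  have h2 : delForm (logPower ρ s θ) z ξ = _ :=
    delForm_comb ((hρ.differentiableAt (by simp)).log h0)
      (contDiff_norm_sq' (n := 1)).contDiffAt.differentiableAt_one s (s * θ) ξ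
  have h3 : delForm (logPower ρ s θ) z ξ
      = s * (delForm ρ z ξ / ρ z + θ * delForm (fun w => ‖w‖ ^ 2) z ξ) := by
    rw [h2, delForm_log (hρ.differentiableAt (by simp)) h0]; push_cast; ring
  rw [h1, h3, leviForm_log hρ h0, leviForm_norm_sq, norm_mul, mul_pow, norm_real,
    Real.norm_eq_abs, sq_abs, div_pow, sq_abs]
  ring

theorem exp_logPower (h0 : ρ z ≠ 0) (s θ : ℝ) :
    Real.exp (logPower ρ s θ z) = |ρ z * Real.exp (θ * ‖z‖ ^ 2)| ^ s := by
  rw [abs_mul, Real.abs_exp, Real.rpow_def_of_pos (mul_pos (abs_pos.2 h0) (Real.exp_pos _)),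
    Real.log_mul (abs_pos.2 h0).ne' (Real.exp_pos _).ne', Real.log_exp, Real.log_abs, logPower]
  ring_nf

theorem hessForm_congr {f g : CC2 → ℝ} (hfg : f =ᶠ[𝓝 z] g) (hg : ContDiffAt ℝ 2 g z) (ξ : CC2) :
    hessForm f z ξ = leviForm g z ξ ξ := by
  rw [hessForm_eq_leviForm (hg.congr_of_eventuallyEq hfg), hfg.leviForm_eq]

theorem leviForm_exp_logPower_neg {κ η δ R : ℝ} (hκη : η + κ = 1) (hη : 0 < η) (hδ : 0 < δ)
    (hpos : ∀ x y : ℝ, 0 < y → 0 < κ / 2 * x ^ 2 - 2 * η * δ * R * x * y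
      - η * δ ^ 2 * R ^ 2 * y ^ 2 + 3 / 4 * δ * y ^ 2)
    (hρ : ContDiffAt ℝ 2 ρ z) (h0 : ρ z < 0) (hz : ‖z‖ ≤ R) {ξ : CC2} (hξ : ξ ≠ 0)
    (hle : -(δ / 4 * ‖ξ‖ ^ 2) - κ / 2 * (‖delForm ρ z ξ‖ / |ρ z|) ^ 2 ≤
      leviForm ρ z ξ ξ / |ρ z|) :
    leviForm (fun w => Real.exp (logPower ρ η (-δ) w)) z ξ ξ < 0 := by
  rw [leviForm_exp_logPower hρ h0.ne]
  refine mul_neg_of_pos_of_neg (Real.exp_pos _) (mul_neg_of_pos_of_neg hη ?_)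
  have hy : 0 < ‖ξ‖ := norm_pos_iff.2 hξ
  have hN : ‖delForm ρ z ξ / ρ z + (-δ : ℝ) * delForm (fun w => ‖w‖ ^ 2) z ξ‖
      ≤ ‖delForm ρ z ξ‖ / |ρ z| + δ * (R * ‖ξ‖) := by
    refine (norm_add_le _ _).trans (add_le_add ?_ ?_)
    · rw [norm_div, norm_real, Real.norm_eq_abs]
    · rw [norm_mul, norm_real, norm_neg, Real.norm_of_nonneg hδ.le]
      exact mul_le_mul_of_nonneg_left ((delForm_norm_sq z ξ).trans (by gcongr)) hδ.le
  have hN2 := pow_le_pow_left₀ (norm_nonneg _) hN 2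
  have hQ : leviForm ρ z ξ ξ / ρ z = -(leviForm ρ z ξ ξ / |ρ z|) := by
    rw [abs_of_neg h0, div_neg, neg_neg]
  rw [hQ]
  have h1 := hpos (‖delForm ρ z ξ‖ / |ρ z|) ‖ξ‖ hy
  set x := ‖delForm ρ z ξ‖ / |ρ z|
  have h2 := mul_le_mul_of_nonneg_left hN2 hη.le
  -- The coefficient of `x²` is `κ/2 - 1 + η = -κ/2`, so the bracket is at most minus the expression
  -- in `hpos`.
  obtain rfl : κ = 1 - η := by linarith
  nlinarith

theorem leviForm_exp_logPower_pos {κ μ δ R : ℝ} (hκμ : κ + 1 = μ) (hμ : 0 < μ) (hδ : 0 < δ)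
    (hpos : ∀ x y : ℝ, 0 < y → 0 < κ / 2 * x ^ 2 - 2 * μ * δ * R * x * y
      - μ * δ ^ 2 * R ^ 2 * y ^ 2 + 3 / 4 * δ * y ^ 2)
    (hρ : ContDiffAt ℝ 2 ρ z) (h0 : 0 < ρ z) (hz : ‖z‖ ≤ R) {ξ : CC2} (hξ : ξ ≠ 0)
    (hle : -(δ / 4 * ‖ξ‖ ^ 2) - κ / 2 * (‖delForm ρ z ξ‖ / |ρ z|) ^ 2 ≤
      leviForm ρ z ξ ξ / |ρ z|) :
    0 < leviForm (fun w => Real.exp (logPower ρ μ δ w)) z ξ ξ := by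
  rw [leviForm_exp_logPower hρ h0.ne']
  refine mul_pos (Real.exp_pos _) (mul_pos hμ ?_)
  have hy : 0 < ‖ξ‖ := norm_pos_iff.2 hξ
  have hx : 0 ≤ ‖delForm ρ z ξ‖ / |ρ z| := by positivity
  have hN : ‖delForm ρ z ξ‖ / |ρ z| - δ * (R * ‖ξ‖) ≤
      ‖delForm ρ z ξ / ρ z + (δ : ℝ) * delForm (fun w => ‖w‖ ^ 2) z ξ‖ := by
    have h1 : ‖(δ : ℂ) * delForm (fun w => ‖w‖ ^ 2) z ξ‖ ≤ δ * (R * ‖ξ‖) := by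
      rw [norm_mul, norm_real, Real.norm_of_nonneg hδ.le]
      exact mul_le_mul_of_nonneg_left ((delForm_norm_sq z ξ).trans (by gcongr)) hδ.le
    have h2 := norm_sub_norm_le (delForm ρ z ξ / (ρ z : ℂ))
      (-((δ : ℂ) * delForm (fun w => ‖w‖ ^ 2) z ξ))
    rw [sub_neg_eq_add, norm_neg, norm_div, norm_real, Real.norm_eq_abs] at h2
    linarith
  rw [abs_of_pos h0] at hle hx hN ⊢
  have h1 := hpos (‖delForm ρ z ξ‖ / ρ z) ‖ξ‖ hy
  set x := ‖delForm ρ z ξ‖ / ρ z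
  set n := ‖delForm ρ z ξ / (ρ z : ℂ) + (δ : ℂ) * delForm (fun w => ‖w‖ ^ 2) z ξ‖ with hn
  have hn0 : 0 ≤ n := norm_nonneg _
  have hR : 0 ≤ R := (norm_nonneg z).trans hz
  -- The lower bound for `n` may be negative and cannot be squared; `n² ≥ 2nx - x²` is used instead.
  have hn2 : x ^ 2 - 2 * δ * R * x * ‖ξ‖ ≤ n ^ 2 := by
    have hm : 0 ≤ δ * (R * ‖ξ‖) := by positivity
    nlinarith [sq_nonneg (n - x), mul_le_mul_of_nonneg_left hN hx]
  have h2 := mul_le_mul_of_nonneg_left hn2 hμ.le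
  have h3 : 0 ≤ μ * δ ^ 2 * R ^ 2 * ‖ξ‖ ^ 2 := by positivity
  obtain rfl : κ = μ - 1 := by linarith
  nlinarith

theorem exists_strictlyPSH_inside (hΩ : IsOpen Ω) (hb : Bornology.IsBounded Ω)
    (h : DefinesOn Ω U ρ) (hU : frontier Ω ⊆ U)
    (hpsh : ∀ q ∈ frontier Ω, ∀ ξ, 0 ≤ leviForm ρ q ξ ξ)
    (htype : ∀ p ∈ frontier Ω, ¬ IsOfType Ω p 4) {η : ℝ} (h0 : 0 < η) (h1 : η < 1) :
    ∃ V r, IsDefiningFunction Ω V r ∧ IsStrictlyPSHOn (fun z => -(-r z) ^ η) (Ω ∩ V) := by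
  obtain ⟨δ, R, hδ, -, hpos, V, hVo, hFV, hVU, hV⟩ :=
    h.exists_nbhd hΩ hb hU hpsh htype (sub_pos.2 h1) h0
  have hr := (h.mono hVo hVU).mul_exp hΩ (-δ)
  have hcd : ∀ z ∈ Ω ∩ V, ContDiffAt ℝ 2 (fun z => Real.exp (logPower ρ η (-δ) z)) z :=
    fun z hz => (contDiffAt_logPower (h.contDiffAt_two (hVU hz.2))
      ((h.neg_iff z (hVU hz.2)).2 hz.1).ne _ _).exp
  have heq : ∀ z ∈ Ω ∩ V, (fun z => -(-(ρ z * Real.exp (-δ * ‖z‖ ^ 2))) ^ η) =ᶠ[𝓝 z]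
      fun z => -Real.exp (logPower ρ η (-δ) z) := by
    intro z hz
    filter_upwards [(hΩ.inter hVo).mem_nhds hz] with w hw
    have hneg : ρ w < 0 := (h.neg_iff w (hVU hw.2)).2 hw.1
    rw [exp_logPower hneg.ne, abs_of_neg (mul_neg_of_neg_of_pos hneg (Real.exp_pos _))]
  refine ⟨V, _, ⟨hr, hFV⟩, fun z hz =>
    ((hcd z hz).neg.congr_of_eventuallyEq (heq z hz)).contDiffWithinAt, fun z hz ξ hξ => ?_⟩
  have hneg : ρ z < 0 := (h.neg_iff z (hVU hz.2)).2 hz.1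
  rw [hessForm_congr (heq z hz) (hcd z hz).neg, leviForm_neg, neg_pos]
  exact leviForm_exp_logPower_neg (by ring) h0 hδ hpos (h.contDiffAt_two (hVU hz.2)) hneg
    (hV z hz.2).2.1 hξ ((hV z hz.2).2.2 hneg.ne ξ)

theorem exists_strictlyPSH_outside (hΩ : IsOpen Ω) (hb : Bornology.IsBounded Ω)
    (h : DefinesOn Ω U ρ) (hU : frontier Ω ⊆ U)
    (hpsh : ∀ q ∈ frontier Ω, ∀ ξ, 0 ≤ leviForm ρ q ξ ξ)
    (htype : ∀ p ∈ frontier Ω, ¬ IsOfType Ω p 4) {μ : ℝ} (h1 : 1 < μ) :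
    ∃ V r, IsDefiningFunction Ω V r ∧ (∀ z ∈ (closure Ω)ᶜ ∩ V, 0 < r z) ∧
      IsStrictlyPSHOn (fun z => r z ^ μ) ((closure Ω)ᶜ ∩ V) := by
  have h0 : 0 < μ := one_pos.trans h1
  obtain ⟨δ, R, hδ, -, hpos, V, hVo, hFV, hVU, hV⟩ :=
    h.exists_nbhd hΩ hb hU hpsh htype (sub_pos.2 h1) h0
  have hr := (h.mono hVo hVU).mul_exp hΩ δ
  have hρpos : ∀ z ∈ (closure Ω)ᶜ ∩ V, 0 < ρ z := fun z hz =>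
    h.pos (hVU hz.2) (hV z hz.2).1 hz.1
  have hcd : ∀ z ∈ (closure Ω)ᶜ ∩ V, ContDiffAt ℝ 2 (fun z => Real.exp (logPower ρ μ δ z)) z :=
    fun z hz => (contDiffAt_logPower (h.contDiffAt_two (hVU hz.2)) (hρpos z hz).ne' _ _).exp
  have heq : ∀ z ∈ (closure Ω)ᶜ ∩ V, (fun z => (ρ z * Real.exp (δ * ‖z‖ ^ 2)) ^ μ) =ᶠ[𝓝 z]
      fun z => Real.exp (logPower ρ μ δ z) := by
    intro z hz
    filter_upwards [(isClosed_closure.isOpen_compl.inter hVo).mem_nhds hz] with w hw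
    have hw0 := hρpos w hw
    rw [exp_logPower hw0.ne', abs_of_pos (mul_pos hw0 (Real.exp_pos _))]
  refine ⟨V, _, ⟨hr, hFV⟩, fun z hz => mul_pos (hρpos z hz) (Real.exp_pos _), fun z hz =>
    ((hcd z hz).congr_of_eventuallyEq (heq z hz)).contDiffWithinAt, fun z hz ξ hξ => ?_⟩
  rw [hessForm_congr (heq z hz) (hcd z hz)]
  exact leviForm_exp_logPower_pos (by ring) h0 hδ hpos (h.contDiffAt_two (hVU hz.2))
    (hρpos z hz) (hV z hz.2).2.1 hξ ((hV z hz.2).2.2 (hρpos z hz).ne' ξ)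

theorem IsStrictlyPSHOn.isPSHOn_congr {f g : CC2 → ℝ} {V : Set CC2} (hV : IsOpen V)
    (hf : IsStrictlyPSHOn f V) (hfg : ∀ z ∈ V, g z = f z) : IsPSHOn g V := by
  refine ⟨hf.1.congr hfg, fun z hz ξ => ?_⟩
  have hfz : ContDiffAt ℝ 2 f z := (hf.1 z hz).contDiffAt (hV.mem_nhds hz)
  have heq : g =ᶠ[𝓝 z] f := by
    filter_upwards [hV.mem_nhds hz] with w hw using hfg w hw
  rw [hessForm_congr heq hfz]
  rcases eq_or_ne ξ 0 with rfl | hξ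
  · simp [leviForm]
  · rw [← hessForm_eq_leviForm hfz]
    exact (hf.2 z hz ξ hξ).le

/-- A defining function `s` can be written as `r + r²` for another one, `r`. -/
theorem IsDefiningFunction.exists_add_sq (hΩ : IsOpen Ω) {s : CC2 → ℝ}
    (hs : IsDefiningFunction Ω U s) :
    ∃ V r, IsDefiningFunction Ω V r ∧ V ⊆ U ∧ ∀ z ∈ V, r z + r z ^ 2 = s z := by
  -- Where `1 + 4s > 0`, the root `(√(1 + 4s) - 1)/2` of `r + r² = s` is smooth and has the sign of
  -- `s`.
  have hVo : IsOpen (U ∩ {z | 0 < 1 + 4 * s z}) :=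
    (continuousOn_const.add (continuousOn_const.mul hs.1.smooth.continuousOn)).isOpen_inter_preimage
      hs.1.isOpen isOpen_Ioi
  have hV := hs.1.mono hVo inter_subset_left
  set V := U ∩ {z | 0 < 1 + 4 * s z} with hVdef
  have hsq : ∀ z ∈ V, √(1 + 4 * s z) ^ 2 = 1 + 4 * s z := fun z hz => Real.sq_sqrt hz.2.le
  have hrs : ∀ z ∈ V, (√(1 + 4 * s z) - 1) / 2 + ((√(1 + 4 * s z) - 1) / 2) ^ 2 = s z := by
    intro z hz
    linear_combination (1 / 4 : ℝ) * hsq z hz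
  have hsm : ContDiffOn ℝ ∞ (fun z => (√(1 + 4 * s z) - 1) / 2) V :=
    (((contDiffOn_const.add (contDiffOn_const.mul hV.smooth)).sqrt
      fun z hz => hz.2.ne').sub contDiffOn_const).div_const 2
  refine ⟨V, fun z => (√(1 + 4 * s z) - 1) / 2, ⟨⟨hVo, hsm, fun z hz => ?_, fun z hz hD => ?_⟩, ?_⟩,
    inter_subset_left, hrs⟩
  · rw [← hV.neg_iff z hz]
    have h1 : √(1 + 4 * s z) < 1 ↔ 1 + 4 * s z < 1 := by
      rw [Real.sqrt_lt' one_pos, one_pow]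
    constructor
    · intro h; linarith [h1.1 (by linarith)]
    · intro h; linarith [h1.2 (by linarith)]
  · refine hV.fderiv_ne_zero z hz ?_
    have hd : DifferentiableAt ℝ (fun z => (√(1 + 4 * s z) - 1) / 2) z :=
      ((hsm z hz.2).contDiffAt (hVo.mem_nhds hz.2)).differentiableAt (by simp)
    have heq : s =ᶠ[𝓝 z] fun z => (√(1 + 4 * s z) - 1) / 2 + ((√(1 + 4 * s z) - 1) / 2) ^ 2 := by
      filter_upwards [hVo.mem_nhds hz.2] with w hw using (hrs w hw).symm
    rw [heq.fderiv_eq, (hd.hasFDerivAt.fun_add (hd.hasFDerivAt.pow 2)).fderiv, hD]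
    simp
  · intro p hp
    refine ⟨hs.2 hp, ?_⟩
    simp [hs.1.eq_zero hΩ ⟨hp, hs.2 hp⟩]

end Exponents

/-! ### The theorem. -/

theorem corollaryC (Ω : Set CC2) (hΩ : IsSmoothlyBoundedDomain Ω) (hpsc : IsPseudoconvex Ω)
    (htype : ∀ p ∈ frontier Ω, ¬ IsOfType Ω p 4)
    (hpsh : ∃ U ρ, IsDefiningFunction Ω U ρ ∧ ∀ p ∈ frontier Ω, ∀ ξ : CC2, 0 ≤ hessForm ρ p ξ) :
    (∀ η : ℝ, 0 < η → η < 1 →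
      ∃ (r : CC2 → ℝ) (K : ℝ) (U : Set CC2), IsDefiningFunction Ω U r ∧ 0 < K ∧
        (∀ z ∈ Ω ∩ U, 0 < -r z - K * r z ^ 2) ∧
        IsPSHOn (fun z => -(-r z - K * r z ^ 2) ^ η) (Ω ∩ U)) ∧
    (∀ μ : ℝ, 1 < μ →
      ∃ (r : CC2 → ℝ) (K : ℝ) (U : Set CC2), IsDefiningFunction Ω U r ∧ 0 < K ∧
        (∀ z ∈ (closure Ω)ᶜ ∩ U, 0 < r z + K * r z ^ 2) ∧
        IsPSHOn (fun z => (r z + K * r z ^ 2) ^ μ) ((closure Ω)ᶜ ∩ U)) ∧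
    dfIndex Ω = 1 ∧ steinnessIndex Ω = 1 := by
  obtain ⟨U, ρ, ⟨hρ, hU⟩, hpsh⟩ := hpsh
  have hpsh' : ∀ q ∈ frontier Ω, ∀ ξ, 0 ≤ leviForm ρ q ξ ξ := fun q hq ξ => by
    rw [← hessForm_eq_leviForm (hρ.contDiffAt_two (hU hq))]
    exact hpsh q hq ξ
  have hin {η : ℝ} (h0 : 0 < η) (h1 : η < 1) :=
    exists_strictlyPSH_inside hΩ.isOpen hΩ.isBounded hρ hU hpsh' htype h0 h1
  have hout {μ : ℝ} (h1 : 1 < μ) :=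
    exists_strictlyPSH_outside hΩ.isOpen hΩ.isBounded hρ hU hpsh' htype h1
  refine ⟨fun η h0 h1 => ?_, fun μ h1 => ?_, ?_, ?_⟩
  · obtain ⟨V, s, hs, hpshs⟩ := hin h0 h1
    obtain ⟨W, r, hr, hWV, hrs⟩ := hs.exists_add_sq hΩ.isOpen
    have hval : ∀ z ∈ W, -r z - 1 * r z ^ 2 = -s z := fun z hz => by rw [← hrs z hz]; ring
    refine ⟨r, 1, W, hr, one_pos, fun z hz => ?_, ?_⟩
    · rw [hval z hz.2, neg_pos]
      exact (hs.1.neg_iff z (hWV hz.2)).2 hz.1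
    · refine IsStrictlyPSHOn.isPSHOn_congr (hΩ.isOpen.inter hr.1.isOpen)
        ⟨hpshs.1.mono (inter_subset_inter_right Ω hWV),
          fun z hz => hpshs.2 z ⟨hz.1, hWV hz.2⟩⟩ fun z hz => ?_
      simp only [hval z hz.2]
  · obtain ⟨V, s, hs, hpos, hpshs⟩ := hout h1
    obtain ⟨W, r, hr, hWV, hrs⟩ := hs.exists_add_sq hΩ.isOpen
    have hval : ∀ z ∈ W, r z + 1 * r z ^ 2 = s z := fun z hz => by rw [one_mul, hrs z hz]
    refine ⟨r, 1, W, hr, one_pos, fun z hz => ?_, ?_⟩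
    · rw [hval z hz.2]
      exact hpos z ⟨hz.1, hWV hz.2⟩
    · refine IsStrictlyPSHOn.isPSHOn_congr (isClosed_closure.isOpen_compl.inter hr.1.isOpen)
        ⟨hpshs.1.mono (inter_subset_inter_right _ hWV),
          fun z hz => hpshs.2 z ⟨hz.1, hWV hz.2⟩⟩ fun z hz => ?_
      simp only [hval z hz.2]
  · refine le_antisymm (iSup₂_le fun η hη => ?_) (le_of_not_gt fun hlt => ?_)
    · rw [← ENNReal.ofReal_one]
      exact ENNReal.ofReal_le_ofReal hη.2.1.le
    -- An index below `1` would leave an admissible exponent strictly above it.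
    · obtain ⟨η, -, hη, hη1⟩ := ENNReal.lt_iff_exists_real_btwn.1 hlt
      have h0 : 0 < η := ENNReal.ofReal_pos.1 (bot_le.trans_lt hη)
      have h1 : η < 1 := ENNReal.ofReal_lt_one.1 hη1
      exact hη.not_ge (le_iSup₂_of_le η ⟨h0, h1, hin h0 h1⟩ le_rfl)
  · refine le_antisymm (le_of_not_gt fun hlt => ?_) (le_iInf₂ fun μ hμ => ?_)
    · obtain ⟨μ, -, hμ1, hμ⟩ := ENNReal.lt_iff_exists_real_btwn.1 hlt
      have h1 : 1 < μ := ENNReal.one_lt_ofReal.1 hμ1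
      obtain ⟨V, s, hs, -, hpshs⟩ := hout h1
      exact hμ.not_ge (iInf₂_le_of_le μ ⟨h1, V, s, hs, hpshs⟩ le_rfl)
    · rw [← ENNReal.ofReal_one]
      exact ENNReal.ofReal_le_ofReal hμ.1.le
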